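/- Let $E$ be a complex Hilbert space of finite dimension, $F$ a real Hilbert space of finite dimension with dual $F'$ and complexification $F_{\mathbb C}$, and let $\Phi\colon E\times E\to F_{\mathbb C}$ be a hermitian map (linear in the first and antilinear in the second variable, with $\Phi(\zeta',\zeta)=\overline{\Phi(\zeta,\zeta')}$). Write $\Phi(\zeta)=\Phi(\zeta,\zeta)\in F$ and $\rho(\zeta,z)=\operatorname{Im}z-\Phi(\zeta)$ for $(\zeta,z)\in E\times F_{\mathbb C}$, and let $\mathcal N=E\times F$, endowed with Lebesgue measure (in any normalization). For $f\colon E\times F_{\mathbb C}\to\mathbb C$ and $h\in F$ define $f_h$ on $\mathcal N$ by $f_h(\zeta,x)=f(\zeta,x+i\Phi(\zeta)+ih)$. For a compact convex set $K\subseteq F'$ let $H_K(h)=\sup_{\lambda\in -K}\langle\lambda,h\rangle$ (so that $H_\emptyset=-\infty$; we put $e^{-\infty}=0$ and $e^{+\infty}\cdot 0=0$). For $p\in(0,\infty]$ let $\mathcal B^p_K$ be the space of all entire functions $f$ on $E\times F_{\mathbb C}$ with $f_0\in L^p(\mathcal N)$ such that for every $\varepsilon>0$ there is $C_\varepsilon>0$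 with $$|f(\zeta,z)|\le C_\varepsilon\, e^{C_\varepsilon(|\zeta|^2+|\operatorname{Re}z|)+H_{K+\overline B_{F'}(0,\varepsilon)}(\rho(\zeta,z))}\qquad\text{for all }(\zeta,z)\in E\times F_{\mathbb C},$$ endowed with the (quasi-)norm $\|f\|_{\mathcal B^p_K}=\|f_0\|_{L^p(\mathcal N)}$. Theorem. Let $K$ be a compact convex subset of $F'$ and let $p\in(0,\infty)$. Then: (1) there is a constant $C>0$ such that $$\|f_h\|_{L^q(\mathcal N)}\le \frac{C}{|h|^{1/p-1/q}}\,e^{H_K(h)}\,\|f\|_{\mathcal B^p_K}$$ for every non-zero $h\in F$, every $q\in[p,\infty]$ and every $f\in\mathcal B^p_K$. Moreover, for every $q\in[p,\infty]$, $\mathcal B^p_K$ embeds continuously into $\mathcal B^q_K$, that is, $\mathcal B^p_K\subseteq\mathcal B^q_K$ and there is a constant $C_q>0$ such that $\|f\|_{\mathcal B^q_K}\le C_q\|f\|_{\mathcal B^p_K}$ for every $f\in\mathcal B^p_K$; (2) for every $f\in\mathcal B^p_K$, $$\lim_{(\zeta,z)\to\infty}e^{-H_K(\rho(\zeta,z))}f(\zeta,z)=0,$$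 the limit being taken in $E\times F_{\mathbb C}$. -/

import Mathlib

open MeasureTheory Filter Topology
open scoped ENNReal Pointwise

/-- The complexification `F_ℂ = F ⊕ iF` of a real Hilbert space `F`, realised as pairs
`(Re z, Im z)` with the Hilbert norm `‖z‖² = ‖Re z‖² + ‖Im z‖²`. -/
def Complexification (F : Type*) : Type _ := WithLp 2 (F × F)

namespace Complexification

/-- The element `x + i y`. -/
def mk {F : Type*} (x y : F) : Complexification F := WithLp.toLp 2 (x, y)

/-- The real part. -/
def re {F : Type*} (z : Complexification F) : F := (WithLp.ofLp z).1

/-- The imaginary part. -/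
def im {F : Type*} (z : Complexification F) : F := (WithLp.ofLp z).2

@[simp] theorem re_mk {F : Type*} (x y : F) : (mk x y).re = x := rfl

@[simp] theorem im_mk {F : Type*} (x y : F) : (mk x y).im = y := rfl

@[ext] theorem ext {F : Type*} {z w : Complexification F}
    (h₁ : z.re = w.re) (h₂ : z.im = w.im) : z = w :=
  WithLp.ofLp_injective 2 (Prod.ext h₁ h₂)

noncomputable instance {F : Type*} [NormedAddCommGroup F] :
    NormedAddCommGroup (Complexification F) :=
  inferInstanceAs (NormedAddCommGroup (WithLp 2 (F × F)))

@[simp] theorem re_add {F : Type*} [NormedAddCommGroup F] (z w : Complexification F) :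
    (z + w).re = z.re + w.re := rfl

@[simp] theorem im_add {F : Type*} [NormedAddCommGroup F] (z w : Complexification F) :
    (z + w).im = z.im + w.im := rfl

@[simp] theorem re_zero {F : Type*} [NormedAddCommGroup F] :
    (0 : Complexification F).re = 0 := rfl

@[simp] theorem im_zero {F : Type*} [NormedAddCommGroup F] :
    (0 : Complexification F).im = 0 := rfl

theorem norm_sq_eq {F : Type*} [NormedAddCommGroup F] (z : Complexification F) :
    ‖z‖ ^ 2 = ‖z.re‖ ^ 2 + ‖z.im‖ ^ 2 :=
  WithLp.prod_norm_sq_eq_of_L2 (α := F) (β := F) z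

/-- `(a + ib)(x + iy) = (ax - by) + i(ay + bx)`. -/
instance {F : Type*} [NormedAddCommGroup F] [InnerProductSpace ℝ F] :
    SMul ℂ (Complexification F) :=
  ⟨fun c z => mk (c.re • z.re - c.im • z.im) (c.re • z.im + c.im • z.re)⟩

@[simp] theorem re_smul {F : Type*} [NormedAddCommGroup F] [InnerProductSpace ℝ F]
    (c : ℂ) (z : Complexification F) : (c • z).re = c.re • z.re - c.im • z.im := rfl

@[simp] theorem im_smul {F : Type*} [NormedAddCommGroup F] [InnerProductSpace ℝ F]
    (c : ℂ) (z : Complexification F) : (c • z).im = c.re • z.im + c.im • z.re := rfl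

instance {F : Type*} [NormedAddCommGroup F] [InnerProductSpace ℝ F] :
    Module ℂ (Complexification F) where
  one_smul z := by ext <;> simp
  mul_smul a b z := by
    ext <;> simp only [re_smul, im_smul, Complex.mul_re, Complex.mul_im] <;> module
  smul_zero a := by ext <;> simp
  smul_add a z w := by ext <;> simp only [re_smul, im_smul, re_add, im_add] <;> module
  add_smul a b z := by
    ext <;> simp only [re_smul, im_smul, re_add, im_add, Complex.add_re, Complex.add_im] <;> module
  zero_smul z := by ext <;> simp

theorem norm_smul_eq {F : Type*} [NormedAddCommGroup F] [InnerProductSpace ℝ F]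
    (c : ℂ) (z : Complexification F) : ‖c • z‖ = ‖c‖ * ‖z‖ := by
  have h : ‖c • z‖ ^ 2 = (‖c‖ * ‖z‖) ^ 2 := by
    rw [mul_pow, norm_sq_eq, norm_sq_eq, re_smul, im_smul, norm_sub_sq_real, norm_add_sq_real,
      Complex.sq_norm, Complex.normSq_apply]
    simp only [norm_smul, real_inner_smul_left, real_inner_smul_right, mul_pow, Real.norm_eq_abs,
      sq_abs, real_inner_comm z.re z.im]
    ring
  exact (sq_eq_sq₀ (norm_nonneg _) (by positivity)).1 h

noncomputable instance {F : Type*} [NormedAddCommGroup F] [InnerProductSpace ℝ F] :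
    NormedSpace ℂ (Complexification F) where
  norm_smul_le c z := (norm_smul_eq c z).le

/-- The conjugation `x + iy ↦ x - iy`. -/
def conj {F : Type*} [NormedAddCommGroup F] (z : Complexification F) : Complexification F :=
  mk z.re (-z.im)

end Complexification

/-- A sesquilinear map `Φ : E × E → F_ℂ`, linear in the first and antilinear in the second
variable, is hermitian if `Φ(ζ', ζ)` is the conjugate of `Φ(ζ, ζ')`. -/
def IsHermitianMap {E F : Type*} [NormedAddCommGroup E] [InnerProductSpace ℂ E]
    [NormedAddCommGroup F] [InnerProductSpace ℝ F]
    (Φ : E →ₗ[ℂ] E →ₗ⋆[ℂ] Complexification F) : Prop :=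
  ∀ ζ ζ' : E, Φ ζ' ζ = (Φ ζ ζ').conj

/-- `Φ(ζ) = Φ(ζ, ζ)`, as an element of `F` (for hermitian `Φ` its imaginary part vanishes). -/
noncomputable def quadPart {E F : Type*} [NormedAddCommGroup E] [InnerProductSpace ℂ E]
    [NormedAddCommGroup F] [InnerProductSpace ℝ F]
    (Φ : E →ₗ[ℂ] E →ₗ⋆[ℂ] Complexification F) (ζ : E) : F :=
  (Φ ζ ζ).re

/-- `ρ(ζ, z) = Im z - Φ(ζ)`. -/
noncomputable def rho {E F : Type*} [NormedAddCommGroup E] [InnerProductSpace ℂ E]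
    [NormedAddCommGroup F] [InnerProductSpace ℝ F]
    (Φ : E →ₗ[ℂ] E →ₗ⋆[ℂ] Complexification F) (w : E × Complexification F) : F :=
  w.2.im - quadPart Φ w.1

/-- `f_h(ζ, x) = f(ζ, x + iΦ(ζ) + ih)`, a function on `𝒩 = E × F`. -/
noncomputable def slice {E F : Type*} [NormedAddCommGroup E] [InnerProductSpace ℂ E]
    [NormedAddCommGroup F] [InnerProductSpace ℝ F]
    (Φ : E →ₗ[ℂ] E →ₗ⋆[ℂ] Complexification F) (f : E × Complexification F → ℂ) (h : F) :
    E × F → ℂ :=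
  fun v => f (v.1, Complexification.mk v.2 (quadPart Φ v.1 + h))

/-- The supporting function `H_K(h) = sup_{l ∈ -K} ⟨l, h⟩`, with `H_∅ = -∞`. -/
noncomputable def suppFun {F : Type*} [NormedAddCommGroup F] [InnerProductSpace ℝ F]
    (K : Set (StrongDual ℝ F)) (h : F) : EReal :=
  ⨆ l ∈ -K, ((l h : ℝ) : EReal)

/-- The space of entire functions of exponential type `K` on `E × F_ℂ`: the entire functions `f`
such that for every `ε > 0` there is `C > 0` with
`|f(ζ, z)| ≤ C exp(C (|ζ|² + |Re z|) + H_{K + B̄(0, ε)}(ρ(ζ, z)))` everywhere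
(in `[0, ∞]`, with `exp(-∞) = 0`). -/
def expTypeSpace {E F : Type*} [NormedAddCommGroup E] [InnerProductSpace ℂ E]
    [NormedAddCommGroup F] [InnerProductSpace ℝ F]
    (Φ : E →ₗ[ℂ] E →ₗ⋆[ℂ] Complexification F) (K : Set (StrongDual ℝ F)) :
    Set (E × Complexification F → ℂ) :=
  {f | Differentiable ℂ f ∧ ∀ ε : ℝ, 0 < ε → ∃ C : ℝ, 0 < C ∧
    ∀ (ζ : E) (z : Complexification F),
      ‖f (ζ, z)‖ₑ ≤ ENNReal.ofReal C *
        EReal.exp (((C * (‖ζ‖ ^ 2 + ‖z.re‖) : ℝ) : EReal) +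
          suppFun (K + Metric.closedBall 0 ε) (rho Φ (ζ, z)))}

/-- The Bernstein space `𝓑^p_K(𝒩)`; `μ` is the Lebesgue measure of `𝒩 = E × F`. -/
def bernsteinSpace {E F : Type*} [NormedAddCommGroup E] [InnerProductSpace ℂ E]
    [NormedAddCommGroup F] [InnerProductSpace ℝ F] [MeasurableSpace E] [MeasurableSpace F]
    (Φ : E →ₗ[ℂ] E →ₗ⋆[ℂ] Complexification F) (μ : Measure (E × F))
    (p : ℝ≥0∞) (K : Set (StrongDual ℝ F)) : Set (E × Complexification F → ℂ) :=
  {f | f ∈ expTypeSpace Φ K ∧ MemLp (slice Φ f 0) p μ}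

/-- The (quasi-)norm `‖f‖_{𝓑^p_K} = ‖f_0‖_{L^p(𝒩)}`. -/
noncomputable def bernsteinNorm {E F : Type*} [NormedAddCommGroup E] [InnerProductSpace ℂ E]
    [NormedAddCommGroup F] [InnerProductSpace ℝ F] [MeasurableSpace E] [MeasurableSpace F]
    (Φ : E →ₗ[ℂ] E →ₗ⋆[ℂ] Complexification F) (μ : Measure (E × F))
    (p : ℝ≥0∞) (f : E × Complexification F → ℂ) : ℝ≥0∞ :=
  eLpNorm (slice Φ f 0) p μ

/-!
The function `‖g‖ ^ p` is subharmonic for every holomorphic `g` and every `p > 0`, also for `p < 1`;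
this follows from Jensen's formula and carries the whole argument. It is used in three ways.

*Plancherel–Pólya.* For a direction `h` and a compact window `Q` of `𝒩 = E × F`, the mean over `Q`
of the `p`-th powers of `f` along the complex lines with direction `h` is a logarithmically
subharmonic function `u` of one complex variable `w` (`windowMean`). After multiplication by a power
of `|exp (iκw)|`, with `κ` slightly larger than `H_K(h)`, it grows at most exponentially in `|Re w|`
on the upper half-plane, and it is bounded by `‖f_0‖_p ^ p` on the real line. The
Phragmén–Lindelöf principle (`windowMean_le_of_upperHalfPlane`) propagates this bound, and
exhausting `𝒩` by windows gives `‖f_h‖_p ≤ exp (H_K(h)) ‖f_0‖_p` (`lintegral_slice_le`).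

*Gain of a power of `‖h‖`.* For a window of size one, the integral of `u` along a horizontal line of
the `w`-plane is `O(1 / ‖h‖)` times the full integral, since a line of direction `h` meets the
window in a set of parameters of length `O(1 / ‖h‖)`. The sub-mean value property on a disc about
`w = i` then bounds the mean of `|f_h| ^ p` over the window (`setLIntegral_slice_comp_le`).

*Pointwise bounds.* The group `𝒩` acts on `E × F_ℂ` by affine automorphisms preserving `ρ`, so the
sub-mean value property on one fixed ball bounds `|f_h(v)| ^ p` by the means of `|f_h'| ^ p` over a
translate of a fixed window, for `h'` near `h`, uniformly in `v` and `h`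
(`exists_enorm_slice_rpow_le`).

Together, `|f_h| ^ p ≤ C exp (p H_K(h)) ‖f_0‖_p ^ p`, with an additional factor `1 / ‖h‖` on the
right if `h ≠ 0` (`exists_enorm_slice_rpow_le_lintegral`); interpolation with the Plancherel–Pólya
inequality yields the estimates for all `q ≥ p`. The limit at infinity
(`tendsto_exp_neg_suppFun_mul`) follows from the factor `1 / ‖ρ‖` where `ρ` is large, and from the
integrability of `|f| ^ p` over `𝒩 × {‖h‖ ≤ R}` where `ρ` is bounded. For empty `K` the growth
condition forces `f = 0`.
-/

/-! ### Sub-mean value properties and the maximum principle -/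

open Metric in
/-- `‖g‖ ^ p` is subharmonic for holomorphic `g` and every `p > 0`: by Jensen's formula `log ‖g‖`
has the sub-mean value property, and `t ↦ exp (p * t)` is convex and increasing. -/
theorem norm_rpow_le_circleAverage {g : ℂ → ℂ} {c : ℂ} {r p : ℝ} (hp : 0 < p) (hr : r ≠ 0)
    (hg : AnalyticOnNhd ℂ g (closedBall c |r|)) :
    ‖g c‖ ^ p ≤ Real.circleAverage (fun z => ‖g z‖ ^ p) c r := by
  have hcont : ContinuousOn (fun z => ‖g z‖ ^ p) (sphere c |r|) := by
    have := (hg.continuousOn.mono sphere_subset_closedBall).norm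
    exact this.rpow_const (fun _ _ => Or.inr hp.le)
  have hint : CircleIntegrable (fun z => ‖g z‖ ^ p) c r := hcont.circleIntegrable'
  by_cases h0 : g c = 0
  · rw [h0, norm_zero, Real.zero_rpow hp.ne']
    exact Real.circleAverage_nonneg_of_nonneg (fun z _ => by positivity)
  have hlog : CircleIntegrable (fun z => Real.log ‖g z‖) c r :=
    (hg.mono sphere_subset_closedBall).meromorphicOn.circleIntegrable_log_norm
  -- The zeros of `g` are discrete, so that `log 0 = 0` does no harm.
  have hne : ∀ᶠ z in codiscreteWithin (sphere c |r|), g z ≠ 0 := by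
    have h1 := hg.eqOn_zero_or_eventually_ne_zero_of_preconnected
      (convex_closedBall c |r|).isPreconnected
    rcases h1 with h1 | h1
    · exact absurd (h1 (mem_closedBall_self (abs_nonneg r))) h0
    · exact h1.filter_mono (codiscreteWithin_mono sphere_subset_closedBall)
  have hexp : Set.EqOn (fun z => (Real.exp (p * Real.log ‖g z‖))) (fun z => ‖g z‖ ^ p)
      {z | g z ≠ 0} := fun z hz => by
    have : 0 < ‖g z‖ := norm_pos_iff.2 hz
    simp only [Real.rpow_def_of_pos this, mul_comm]
  have heq : (fun z => ‖g z‖ ^ p) =ᶠ[codiscreteWithin (sphere c |r|)]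
      fun z => Real.exp (p * Real.log ‖g z‖) := by
    filter_upwards [hne] with z hz using (hexp hz).symm
  have hjensen : Real.log ‖g c‖ ≤ Real.circleAverage (fun z => Real.log ‖g z‖) c r := by
    rw [hg.circleAverage_log_norm hr h0]
    have : 0 ≤ ∑ᶠ u, (MeromorphicOn.divisor g (closedBall c |r|) u : ℝ)
        * Real.log (r * ‖c - u‖⁻¹) := by
      refine finsum_nonneg fun u => ?_
      by_cases hu : u ∈ closedBall c |r|
      · refine mul_nonneg ?_ ?_
        · exact_mod_cast MeromorphicOn.AnalyticOnNhd.divisor_nonneg hg u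
        · rw [← Real.log_abs, abs_mul, abs_inv, abs_norm]
          rcases eq_or_ne c u with rfl | hcu
          · simp
          · refine Real.log_nonneg ?_
            have h2 : 0 < ‖c - u‖ := norm_pos_iff.2 (sub_ne_zero.2 hcu)
            rw [← div_eq_mul_inv, one_le_div h2]
            rwa [mem_closedBall', dist_eq_norm] at hu
      · rw [Function.locallyFinsuppWithin.apply_eq_zero_of_notMem _ hu]
        simp
    linarith
  have hint' : CircleIntegrable (fun z => Real.exp (p * Real.log ‖g z‖)) c r :=
    hint.congr_codiscreteWithin heq
  rw [Real.circleAverage_congr_codiscreteWithin heq hr]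
  have hgc : ‖g c‖ ^ p = Real.exp (p * Real.log ‖g c‖) := by
    rw [Real.rpow_def_of_pos (norm_pos_iff.2 h0), mul_comm]
  rw [hgc]
  refine (Real.exp_le_exp.2 (mul_le_mul_of_nonneg_left hjensen hp.le)).trans ?_
  rw [Real.circleAverage_eq_intervalAverage, Real.circleAverage_eq_intervalAverage]
  have hconv : ConvexOn ℝ Set.univ (fun x : ℝ => Real.exp (p * x)) := by
    have := convexOn_exp.comp_linearMap (LinearMap.mulLeft ℝ p)
    simpa [Function.comp_def] using this
  have h2pi : (0:ℝ) < 2 * Real.pi := by positivity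
  refine hconv.map_set_average_le (f := fun θ => Real.log ‖g (circleMap c r θ)‖)
    (by fun_prop) isClosed_univ ?_ ?_ (by simp) ?_ ?_
  · simpa [Set.uIoc_of_le h2pi.le] using Real.pi_pos
  · rw [Set.uIoc_of_le h2pi.le]
    exact measure_Ioc_lt_top.ne
  · exact (intervalIntegrable_iff.1 hlog)
  · exact (intervalIntegrable_iff.1 hint')

/-- Unnormalised sub-mean value property of `‖g‖ ^ p` on the unit circle. -/
theorem enorm_rpow_le_lintegral_circle {g : ℂ → ℂ} {p : ℝ} (hp : 0 < p)
    (hg : AnalyticOnNhd ℂ g (Metric.closedBall 0 1)) :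
    ‖g 0‖ₑ ^ p * ENNReal.ofReal (2 * Real.pi) ≤
      ∫⁻ θ in Set.Ioc 0 (2 * Real.pi), ‖g (circleMap 0 1 θ)‖ₑ ^ p := by
  have h2pi : (0:ℝ) < 2 * Real.pi := by positivity
  have h := norm_rpow_le_circleAverage (g := g) (c := 0) (r := 1) hp one_ne_zero (by simpa using hg)
  have hcont : ContinuousOn (fun z => ‖g z‖ ^ p) (Metric.sphere 0 1) :=
    (hg.continuousOn.mono Metric.sphere_subset_closedBall).norm.rpow_const
      (fun _ _ => Or.inr hp.le)
  have hint : CircleIntegrable (fun z => ‖g z‖ ^ p) 0 1 := hcont.circleIntegrable zero_le_one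
  rw [Real.circleAverage_def, smul_eq_mul, inv_mul_eq_div, le_div_iff₀ h2pi,
    intervalIntegral.integral_of_le h2pi.le] at h
  have e : ∀ z : ℂ, ‖z‖ₑ ^ p = ENNReal.ofReal (‖z‖ ^ p) := fun z => by
    rw [← ENNReal.ofReal_rpow_of_nonneg (norm_nonneg _) hp.le, ofReal_norm]
  simp_rw [e]
  rw [← ENNReal.ofReal_mul (by positivity), ← ofReal_integral_eq_lintegral_ofReal]
  · exact ENNReal.ofReal_le_ofReal h
  · exact (intervalIntegrable_iff_integrableOn_Ioc_of_le h2pi.le).1 hint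
  · exact Eventually.of_forall fun _ => by positivity

/-- Multiplication by a complex number of modulus one maps the unit ball onto itself, hence has
real determinant `±1`. -/
theorem measurePreserving_unit_smul {V : Type*} [NormedAddCommGroup V] [NormedSpace ℂ V]
    [FiniteDimensional ℂ V] [MeasurableSpace V] [BorelSpace V] (m : Measure V)
    [m.IsAddHaarMeasure] {a : ℂ} (ha : ‖a‖ = 1) : MeasurePreserving (fun b : V => a • b) m m := by
  let _ : NormedSpace ℝ V := NormedSpace.complexToReal
  have : FiniteDimensional ℝ V := FiniteDimensional.complexToReal V
  have ha0 : a ≠ 0 := by rintro rfl; simp at ha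
  have hmeas : Measurable (fun b : V => a • b) := (continuous_const_smul a).measurable
  let L : V →ₗ[ℝ] V := (LinearMap.lsmul ℂ V a).restrictScalars ℝ
  have hL : ∀ b, L b = a • b := fun b => rfl
  have himg : L '' Metric.closedBall 0 1 = Metric.closedBall 0 1 := by
    ext b
    constructor
    · rintro ⟨b, hb, rfl⟩
      simpa [hL, norm_smul, ha] using hb
    · intro hb
      refine ⟨a⁻¹ • b, ?_, ?_⟩
      · simpa [norm_smul, ha] using hb
      · simp [hL, smul_smul, ha0]
  have h1 := Measure.addHaar_image_linearMap m L (Metric.closedBall 0 1)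
  rw [himg] at h1
  have hpos : m (Metric.closedBall 0 1) ≠ 0 := (Metric.measure_closedBall_pos m 0 one_pos).ne'
  have hfin : m (Metric.closedBall 0 1) ≠ ∞ := (isCompact_closedBall 0 1).measure_lt_top.ne
  have hdet : ENNReal.ofReal |LinearMap.det L| = 1 := by
    have := h1.symm
    rwa [ENNReal.mul_eq_right hpos hfin] at this
  have hdet0 : LinearMap.det L ≠ 0 := by
    intro h; simp [h] at hdet
  have habs : |LinearMap.det L| = 1 := by simpa using hdet
  refine ⟨hmeas, ?_⟩
  have := Measure.map_linearMap_addHaar_eq_smul_addHaar m hdet0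
  rw [abs_inv, habs] at this
  rwa [inv_one, ENNReal.ofReal_one, one_smul] at this

/-- Sub-mean value property of `‖f‖ ^ p` on balls of a complex vector space, for any Haar measure:
average the inequality on the circles `θ ↦ c + e ^ (iθ) b` over `b` in the ball. -/
theorem enorm_rpow_mul_measure_le {V : Type*} [NormedAddCommGroup V] [NormedSpace ℂ V]
    [FiniteDimensional ℂ V] [MeasurableSpace V] [BorelSpace V] (m : Measure V)
    [m.IsAddHaarMeasure] {p : ℝ} (hp : 0 < p) {f : V → ℂ} {Ω : Set V} (hΩ : IsOpen Ω)
    (hf : DifferentiableOn ℂ f Ω) {c : V} {r : ℝ} (hr : Metric.closedBall c r ⊆ Ω) :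
    ‖f c‖ₑ ^ p * m (Metric.closedBall 0 r) ≤
      ∫⁻ b in Metric.closedBall 0 r, ‖f (c + b)‖ₑ ^ p ∂m := by
  classical
  have : ProperSpace V := FiniteDimensional.proper ℂ V
  set B : Set V := Metric.closedBall 0 r
  have hB : MeasurableSet B := Metric.isClosed_closedBall.measurableSet
  have hmem : ∀ b ∈ B, c + b ∈ Ω := fun b hb => hr (by simpa [B] using hb)
  let F : V → ℝ≥0∞ := B.indicator (fun b => ‖f (c + b)‖ₑ ^ p)
  have hF : Measurable F := by
    have h1 : ContinuousOn (fun b => ‖f (c + b)‖ₑ ^ p) B := by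
      refine ENNReal.continuous_rpow_const.comp_continuousOn (continuous_enorm.comp_continuousOn ?_)
      exact hf.continuousOn.comp (by fun_prop) hmem
    have := h1.measurable_piecewise (g := 0) continuousOn_const hB
    rwa [Set.piecewise_eq_indicator] at this
  rw [← lintegral_indicator hB]
  change _ ≤ ∫⁻ b, F b ∂m
  have hrot : ∀ θ : ℝ, ∫⁻ b, F (circleMap 0 1 θ • b) ∂m = ∫⁻ b, F b ∂m := fun θ =>
    (measurePreserving_unit_smul m (a := circleMap 0 1 θ) (by simp)).lintegral_comp hF
  have hpt : ∀ b, B.indicator (fun _ => ‖f c‖ₑ ^ p * ENNReal.ofReal (2 * Real.pi)) b ≤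
      ∫⁻ θ in Set.Ioc 0 (2 * Real.pi), F (circleMap 0 1 θ • b) := by
    intro b
    by_cases hb : b ∈ B
    · rw [Set.indicator_of_mem hb]
      have hopen : IsOpen {l : ℂ | c + l • b ∈ Ω} := hΩ.preimage (by fun_prop)
      have hsub : Metric.closedBall (0:ℂ) 1 ⊆ {l : ℂ | c + l • b ∈ Ω} := by
        intro l hl
        refine hmem _ ?_
        have hl' : ‖l‖ ≤ 1 := by simpa using hl
        have hb' : ‖b‖ ≤ r := by simpa [B] using hb
        have : ‖l • b‖ ≤ r := by
          rw [norm_smul]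
          exact (mul_le_of_le_one_left (norm_nonneg _) hl').trans hb'
        simpa [B] using this
      have hd : DifferentiableOn ℂ (fun l : ℂ => f (c + l • b)) {l : ℂ | c + l • b ∈ Ω} :=
        hf.comp (by fun_prop) (fun l hl => hl)
      have := enorm_rpow_le_lintegral_circle hp ((hd.analyticOnNhd hopen).mono hsub)
      rw [zero_smul, add_zero] at this
      refine this.trans (le_of_eq ?_)
      refine lintegral_congr fun θ => ?_
      have : circleMap 0 1 θ • b ∈ B := by
        simpa [B, norm_smul] using hb
      simp only [F, Set.indicator_of_mem this]
    · rw [Set.indicator_of_notMem hb]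
      exact zero_le
  have h2pi : (0:ℝ) < 2 * Real.pi := by positivity
  have key := lintegral_mono (μ := m) hpt
  rw [lintegral_indicator_const hB, lintegral_lintegral_swap] at key
  · simp_rw [hrot] at key
    rw [lintegral_const, Measure.restrict_apply_univ, Real.volume_Ioc, sub_zero,
      mul_right_comm] at key
    exact (ENNReal.mul_le_mul_iff_left (by simpa using h2pi)
      ENNReal.ofReal_ne_top).1 key
  · refine Measurable.aemeasurable ?_
    exact hF.comp (((continuous_circleMap 0 1).comp continuous_snd).smul continuous_fst).measurable

/-- Weak maximum principle for continuous functions with the sub-mean value property on discs. -/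
theorem le_of_subMean_of_le_frontier {K : Set ℂ} (hK : IsCompact K) {v : ℂ → ℝ≥0∞}
    (hv : ContinuousOn v K) {M : ℝ≥0∞} (hfin : ∀ w ∈ K, v w ≠ ∞)
    (hsub : ∀ c r, 0 < r → Metric.closedBall c r ⊆ interior K →
      v c * volume (Metric.closedBall (0:ℂ) r) ≤ ∫⁻ b in Metric.closedBall (0:ℂ) r, v (c + b))
    (hM : ∀ w ∈ K, w ∉ interior K → v w ≤ M) : ∀ w ∈ K, v w ≤ M := by
  intro w hw
  obtain ⟨c₀, hc₀, hmax⟩ := hK.exists_isMaxOn ⟨w, hw⟩ hv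
  refine (hmax hw).trans ?_
  -- A maximum point with the largest real part cannot be interior: `v` would be maximal almost
  -- everywhere on a disc about it, also to the right of the centre.
  set S : Set ℂ := K ∩ v ⁻¹' {v c₀}
  have hS : IsCompact S := by
    have : IsClosed S := hv.preimage_isClosed_of_isClosed hK.isClosed isClosed_singleton
    exact hK.of_isClosed_subset this Set.inter_subset_left
  obtain ⟨c, hc, hcmax⟩ := hS.exists_isMaxOn ⟨c₀, hc₀, rfl⟩ Complex.continuous_re.continuousOn
  have hvc : v c = v c₀ := hc.2
  by_contra hlt
  have hint : c ∈ interior K := by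
    by_contra hni
    exact hlt (hvc ▸ hM c hc.1 hni)
  obtain ⟨r, hr, hball⟩ := Metric.nhds_basis_closedBall.mem_iff.1 (isOpen_interior.mem_nhds hint)
  set B : Set ℂ := Metric.closedBall (0:ℂ) r
  have hmem : ∀ b ∈ B, c + b ∈ K := fun b hb =>
    interior_subset (hball (by simpa [B] using hb))
  have hB : MeasurableSet B := Metric.isClosed_closedBall.measurableSet
  have hcontB : ContinuousOn (fun b => v (c + b)) B := hv.comp (by fun_prop) hmem
  have hBfin : volume B ≠ ∞ := (isCompact_closedBall (0:ℂ) r).measure_lt_top.ne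
  have hle : (fun b => v (c + b)) ≤ᵐ[volume.restrict B] fun _ => v c := by
    refine (ae_restrict_iff' hB).2 (Eventually.of_forall fun b hb => ?_)
    rw [hvc]
    exact hmax (hmem b hb)
  have hae := ae_eq_of_ae_le_of_lintegral_le hle
    ((lintegral_mono_ae hle).trans_lt (by
      rw [lintegral_const, Measure.restrict_apply_univ]
      exact ENNReal.mul_lt_top (hfin c hc.1).lt_top hBfin.lt_top)).ne
    aemeasurable_const
    (by
      rw [lintegral_const, Measure.restrict_apply_univ]
      exact hsub c r hr hball)
  rw [Filter.EventuallyEq, ae_restrict_iff' hB] at hae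
  have hhalf : IsOpen {b : ℂ | 0 < b.re ∧ ‖b‖ < r} :=
    (isOpen_lt continuous_const Complex.continuous_re).inter (isOpen_lt continuous_norm
      continuous_const)
  have hne : {b : ℂ | 0 < b.re ∧ ‖b‖ < r}.Nonempty :=
    ⟨((r / 2 : ℝ) : ℂ), by simp [abs_of_pos hr, hr]⟩
  obtain ⟨b, hbmem, hb⟩ := (hae.and_frequently
    (frequently_ae_mem_iff.2 (hhalf.measure_pos volume hne).ne')).exists
  have hbB : b ∈ B := by simpa [B] using hb.2.le
  have hcb : c + b ∈ S := ⟨hmem b hbB, (hbmem hbB).trans hvc⟩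
  have := hcmax hcb
  simp only [Set.mem_ofPred_eq, Complex.add_re] at this
  linarith [hb.1]

/-! ### Phragmén–Lindelöf principles -/

section WindowMean

variable {X : Type*} [NormedAddCommGroup X] [MeasurableSpace X] [BorelSpace X]
  {ν : Measure X} {Q : Set X} {p : ℝ} {g : ℂ → X → ℂ}

/-- The integral over the window `Q` of the `p`-th power of the modulus of a family `g w` of
functions, as a function of the complex parameter `w`. When `g` is holomorphic in `w`, this is a
logarithmically subharmonic function of `w`. -/
noncomputable def windowMean {X : Type*} [MeasurableSpace X] (ν : Measure X) (Q : Set X) (p : ℝ)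
    (g : ℂ → X → ℂ) (w : ℂ) : ℝ≥0∞ :=
  ∫⁻ q in Q, ‖g w q‖ₑ ^ p ∂ν

theorem enorm_rpow_eq_ofReal (hp : 0 < p) (z : ℂ) : ‖z‖ₑ ^ p = ENNReal.ofReal (‖z‖ ^ p) := by
  rw [← ENNReal.ofReal_rpow_of_nonneg (norm_nonneg _) hp.le, ofReal_norm]

theorem windowMean_eq_ofReal [IsLocallyFiniteMeasure ν] (hp : 0 < p) (hQ : IsCompact Q)
    (hg : Continuous (Function.uncurry g)) (w : ℂ) :
    windowMean ν Q p g w = ENNReal.ofReal (∫ q in Q, ‖g w q‖ ^ p ∂ν) := by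
  have hgw : Continuous (g w) := hg.comp (Continuous.prodMk_right w)
  rw [windowMean, ofReal_integral_eq_lintegral_ofReal]
  · simp_rw [enorm_rpow_eq_ofReal hp]
  · exact ((hgw.norm.rpow_const fun _ => Or.inr hp.le).continuousOn).integrableOn_compact hQ
  · exact Eventually.of_forall fun _ => by positivity

theorem continuous_windowMean [IsLocallyFiniteMeasure ν] (hp : 0 < p) (hQ : IsCompact Q)
    (hg : Continuous (Function.uncurry g)) : Continuous (windowMean ν Q p g) := by
  have : windowMean ν Q p g = fun w => ENNReal.ofReal (∫ q in Q, ‖g w q‖ ^ p ∂ν) :=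
    funext fun w => windowMean_eq_ofReal hp hQ hg w
  rw [this]
  refine ENNReal.continuous_ofReal.comp ?_
  refine continuous_parametric_integral_of_continuous ?_ hQ
  exact hg.norm.rpow_const fun _ => Or.inr hp.le

/-- Sub-mean value property of `windowMean` multiplied by the modulus of a power of the nowhere
vanishing holomorphic function `exp φ`. -/
theorem windowMean_weighted_subMean [SFinite ν] (hp : 0 < p)
    (hg : Continuous (Function.uncurry g)) (hd : ∀ q, Differentiable ℂ fun w => g w q)
    {Ω : Set ℂ} (hΩ : IsOpen Ω) {φ : ℂ → ℂ} (hφ : DifferentiableOn ℂ φ Ω) {c : ℂ} {r : ℝ}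
    (hr : Metric.closedBall c r ⊆ Ω) :
    (‖Complex.exp (φ c)‖ₑ ^ p * windowMean ν Q p g c) * volume (Metric.closedBall (0 : ℂ) r) ≤
      ∫⁻ b in Metric.closedBall (0 : ℂ) r,
        ‖Complex.exp (φ (c + b))‖ₑ ^ p * windowMean ν Q p g (c + b) := by
  have hmeas : ∀ w, Measurable fun q => ‖g w q‖ₑ ^ p := fun w => by
    have : Continuous (g w) := hg.comp (Continuous.prodMk_right w)
    exact this.measurable.enorm.pow_const p
  have hmem : ∀ b ∈ Metric.closedBall (0 : ℂ) r, c + b ∈ Ω := fun b hb => hr (by simpa using hb)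
  have hB : MeasurableSet (Metric.closedBall (0 : ℂ) r) := Metric.isClosed_closedBall.measurableSet
  have hL : (‖Complex.exp (φ c)‖ₑ ^ p * windowMean ν Q p g c) *
      volume (Metric.closedBall (0 : ℂ) r) =
      ∫⁻ q in Q, ‖Complex.exp (φ c) * g c q‖ₑ ^ p * volume (Metric.closedBall (0 : ℂ) r) ∂ν := by
    rw [windowMean, ← lintegral_const_mul _ (hmeas c), ← lintegral_mul_const]
    · simp_rw [enorm_mul, ENNReal.mul_rpow_of_nonneg _ _ hp.le]
    · exact (hmeas c).const_mul _
  have hR : ∫⁻ b in Metric.closedBall (0 : ℂ) r,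
        ‖Complex.exp (φ (c + b))‖ₑ ^ p * windowMean ν Q p g (c + b) =
      ∫⁻ q in Q, ∫⁻ b in Metric.closedBall (0 : ℂ) r,
        ‖Complex.exp (φ (c + b)) * g (c + b) q‖ₑ ^ p ∂volume ∂ν := by
    rw [lintegral_lintegral_swap]
    · refine lintegral_congr fun b => ?_
      rw [windowMean, ← lintegral_const_mul _ (hmeas _)]
      simp_rw [enorm_mul, ENNReal.mul_rpow_of_nonneg _ _ hp.le]
    · refine AEMeasurable.pow_const (AEMeasurable.enorm ?_) p
      refine AEMeasurable.mul ?_ ?_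
      · have : AEMeasurable (fun b => Complex.exp (φ (c + b)))
            (volume.restrict (Metric.closedBall (0 : ℂ) r)) := by
          refine ContinuousOn.aemeasurable ?_ hB
          exact Complex.continuous_exp.comp_continuousOn
            (hφ.continuousOn.comp (by fun_prop) hmem)
        exact this.comp_snd
      · have : Continuous fun z : X × ℂ => g (c + z.2) z.1 :=
          hg.comp (g := Function.uncurry g) (f := fun z : X × ℂ => (c + z.2, z.1)) (by fun_prop)
        exact this.aemeasurable
  rw [hL, hR]
  refine lintegral_mono fun q => ?_
  exact enorm_rpow_mul_measure_le volume hp hΩ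
    (f := fun w => Complex.exp (φ w) * g w q) (hφ.cexp.mul (hd q).differentiableOn) hr

variable [IsLocallyFiniteMeasure ν] [SFinite ν]

/-- **Phragmén–Lindelöf principle** for `windowMean` on a closed set `S`, with `exp (-δ * φ)` as
auxiliary function: if `windowMean` grows slower than `exp (δ * Re φ)` for every `δ > 0`, then a
bound on the frontier of `S` holds on all of `S`. -/
theorem windowMean_le_of_le_frontier (hp : 0 < p) (hQ : IsCompact Q)
    (hg : Continuous (Function.uncurry g)) (hd : ∀ q, Differentiable ℂ fun w => g w q)
    {S Ω : Set ℂ} (hS : IsClosed S) (hΩ : IsOpen Ω) (hSΩ : S ⊆ Ω) {φ : ℂ → ℂ}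
    (hφ : DifferentiableOn ℂ φ Ω) (hpos : ∀ w ∈ S, 0 ≤ (φ w).re) {M : ℝ} (hM : 0 ≤ M)
    (hgrow : ∀ δ > 0, ∀ᶠ R in atTop, ∀ w ∈ S, ‖w‖ = R →
      windowMean ν Q p g w ≤ ENNReal.ofReal (M * Real.exp (δ * (φ w).re)))
    (hbd : ∀ w ∈ S, w ∉ interior S → windowMean ν Q p g w ≤ ENNReal.ofReal M) :
    ∀ w ∈ S, windowMean ν Q p g w ≤ ENNReal.ofReal M := by
  intro w hw
  have main : ∀ δ > 0, windowMean ν Q p g w ≤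
      ENNReal.ofReal (M * Real.exp (δ * (φ w).re)) := by
    intro δ hδ
    obtain ⟨R, hR, hRw⟩ := ((hgrow δ hδ).and (eventually_gt_atTop ‖w‖)).exists
    set ψ : ℂ → ℂ := fun z => -((δ / p : ℝ) : ℂ) * φ z with hψ
    have hψd : DifferentiableOn ℂ ψ Ω := hφ.const_mul _
    have hnorm : ∀ z, ‖Complex.exp (ψ z)‖ₑ ^ p = ENNReal.ofReal (Real.exp (-(δ * (φ z).re))) := by
      intro z
      rw [enorm_rpow_eq_ofReal hp, Complex.norm_exp, ← Real.exp_mul]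
      congr 2
      simp only [hψ, ← Complex.ofReal_neg, Complex.re_ofReal_mul]
      field_simp
    -- Apply the maximum principle on a truncation of `S`.
    set K : Set ℂ := S ∩ Metric.closedBall 0 R with hKdef
    have hK : IsCompact K := (isCompact_closedBall 0 R).inter_left hS
    have hKΩ : K ⊆ Ω := fun z hz => hSΩ hz.1
    have hmul : ∀ z (T : ℝ), 0 ≤ T →
        windowMean ν Q p g z ≤ ENNReal.ofReal (T * Real.exp (δ * (φ z).re)) →
        ‖Complex.exp (ψ z)‖ₑ ^ p * windowMean ν Q p g z ≤ ENNReal.ofReal T := by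
      intro z T hT h
      rw [hnorm]
      refine (mul_le_mul_right h _).trans ?_
      rw [← ENNReal.ofReal_mul (Real.exp_pos _).le]
      refine ENNReal.ofReal_le_ofReal (le_of_eq ?_)
      rw [mul_left_comm, ← Real.exp_add]
      simp
    have key := le_of_subMean_of_le_frontier hK
      (v := fun z => ‖Complex.exp (ψ z)‖ₑ ^ p * windowMean ν Q p g z) (M := ENNReal.ofReal M)
      ?_ ?_ ?_ ?_ w ⟨hw, by simpa using hRw.le⟩
    · rw [hnorm] at key
      have h2 := mul_le_mul_right key (ENNReal.ofReal (Real.exp (δ * (φ w).re)))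
      rw [← mul_assoc, ← ENNReal.ofReal_mul (Real.exp_pos _).le, ← Real.exp_add,
        ← ENNReal.ofReal_mul (Real.exp_pos _).le] at h2
      simpa [mul_comm M] using h2
    · simp_rw [hnorm]
      refine ContinuousOn.ennreal_mul ?_ (continuous_windowMean hp hQ hg).continuousOn ?_ ?_
      · refine ENNReal.continuous_ofReal.comp_continuousOn ?_
        have := (Complex.continuous_re.comp_continuousOn (hφ.continuousOn.mono hKΩ))
        exact Real.continuous_exp.comp_continuousOn (this.const_smul δ).neg
      · intro z hz
        exact Or.inr (by rw [windowMean_eq_ofReal hp hQ hg]; exact ENNReal.ofReal_ne_top)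
      · intro z hz
        exact Or.inr ENNReal.ofReal_ne_top
    · intro z hz
      rw [hnorm, windowMean_eq_ofReal hp hQ hg]
      exact ENNReal.mul_ne_top ENNReal.ofReal_ne_top ENNReal.ofReal_ne_top
    · intro c r hr hball
      exact windowMean_weighted_subMean hp hg hd hΩ hψd
        (hball.trans (interior_subset.trans hKΩ))
    · intro z hz hzi
      refine hmul z M hM ?_
      by_cases hzR : ‖z‖ = R
      · exact hR z hz.1 hzR
      · have hzlt : ‖z‖ < R := lt_of_le_of_ne (by simpa using hz.2) hzR
        refine (hbd z hz.1 fun hzS => hzi ?_).trans ?_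
        · rw [hKdef, interior_inter]
          exact ⟨hzS, Metric.ball_subset_interior_closedBall (by simpa using hzlt)⟩
        · refine ENNReal.ofReal_le_ofReal (le_mul_of_one_le_right hM (Real.one_le_exp ?_))
          exact mul_nonneg hδ.le (hpos z hz.1)
  have hlim : Tendsto (fun δ : ℝ => ENNReal.ofReal (M * Real.exp (δ * (φ w).re))) (𝓝[>] 0)
      (𝓝 (ENNReal.ofReal M)) := by
    have : Continuous fun δ : ℝ => ENNReal.ofReal (M * Real.exp (δ * (φ w).re)) := by
      refine ENNReal.continuous_ofReal.comp (by fun_prop)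
    have h0 := this.tendsto 0
    simp only [zero_mul, Real.exp_zero, mul_one] at h0
    exact h0.mono_left nhdsWithin_le_nhds
  exact ge_of_tendsto hlim (eventually_nhdsWithin_of_forall fun δ hδ => main δ hδ)

/-- On the sector `|Im w| ≤ Re w` the real part of `(w + 1) ^ (3 / 2)` is comparable with
`|w + 1| ^ (3 / 2)`. With `u` the square root of `w + 1`, the sector condition forces
`4 (Im u)² ≤ (Re u)²`. -/
theorem re_sqrt_pow_three_ge {w : ℂ} (hw : |w.im| ≤ w.re) :
    0 < (w + 1).sqrt.re ∧ ‖w + 1‖ ≤ 2 * (w + 1).sqrt.re ^ 2 ∧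
      (w + 1).sqrt.re ^ 3 / 4 ≤ ((w + 1).sqrt ^ 3).re := by
  have hre : 0 ≤ w.re := (abs_nonneg _).trans hw
  set u := (w + 1).sqrt with hu
  have hsq : u ^ 2 = w + 1 := by
    rw [hu, Complex.sqrt, ← Complex.cpow_nat_mul]
    simp
  have hpos : 0 < u.re := by
    rw [hu, Complex.sqrt, Complex.cpow_inv_two_re]
    refine Real.sqrt_pos.2 ?_
    have := norm_nonneg (w + 1)
    simp only [Complex.add_re, Complex.one_re]
    linarith
  have h1 : u.re ^ 2 - u.im ^ 2 = w.re + 1 := by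
    have := congrArg Complex.re hsq
    simpa [pow_two] using this
  have h2 : 2 * u.re * u.im = w.im := by
    have := congrArg Complex.im hsq
    simp [pow_two] at this
    linarith
  have h3 : 2 * u.re * |u.im| ≤ u.re ^ 2 - u.im ^ 2 := by
    have : |w.im| = 2 * u.re * |u.im| := by
      rw [← h2, abs_mul, abs_of_pos (by positivity : 0 < 2 * u.re)]
    rw [← this, h1]; linarith
  have h4 : 4 * u.im ^ 2 ≤ u.re ^ 2 := by
    rw [← sq_abs u.im] at h3 ⊢
    have := abs_nonneg u.im
    nlinarith
  refine ⟨hpos, ?_, ?_⟩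
  · rw [← hsq, norm_pow, Complex.sq_norm, Complex.normSq_apply]
    nlinarith
  · have : (u ^ 3).re = u.re * (u.re ^ 2 - 3 * u.im ^ 2) := by
      simp [pow_succ]
      ring
    rw [this]
    nlinarith

/-- Exponential growth is negligible against growth of order `3 / 2`. -/
theorem eventually_forall_mul_exp_le {C M δ : ℝ} (hM : 0 < M) (hδ : 0 < δ) :
    ∀ᶠ R : ℝ in atTop, ∀ x : ℝ, 0 < x → R ≤ 2 * x ^ 2 →
      C * Real.exp (C * R) ≤ M * Real.exp (δ * (x ^ 3 / 4)) := by
  have hlim₁ : Tendsto (fun R : ℝ => δ / 8 * √(R / 2)) atTop atTop :=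
    (Real.tendsto_sqrt_atTop.comp (tendsto_id.atTop_div_const two_pos)).const_mul_atTop
      (by positivity)
  have hlim₂ : Tendsto (fun R : ℝ => M * Real.exp R) atTop atTop :=
    Real.tendsto_exp_atTop.const_mul_atTop hM
  filter_upwards [hlim₁.eventually_ge_atTop (|C| + 1), hlim₂.eventually_ge_atTop |C|,
    eventually_gt_atTop 0] with R h1 h2 hR x hx hxR
  have h3 : √(R / 2) ≤ x := by
    rw [Real.sqrt_le_left hx.le]
    linarith
  have h4 : (|C| + 1) * R ≤ δ * (x ^ 3 / 4) := by
    have h5 : |C| + 1 ≤ δ / 8 * x := h1.trans (by gcongr)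
    calc (|C| + 1) * R ≤ δ / 8 * x * (2 * x ^ 2) := by gcongr
      _ = δ * (x ^ 3 / 4) := by ring
  calc C * Real.exp (C * R) ≤ |C| * Real.exp (|C| * R) := by gcongr <;> exact le_abs_self C
    _ ≤ M * Real.exp R * Real.exp (|C| * R) := by gcongr
    _ = M * Real.exp ((|C| + 1) * R) := by rw [mul_assoc, ← Real.exp_add]; ring_nf
    _ ≤ _ := by gcongr

/-- Phragmén–Lindelöf principle in a sector of opening `π / 2`, for functions of exponential type.
The auxiliary exponent is `(w + 1) ^ (3 / 2)`. -/
theorem windowMean_le_of_sector (hp : 0 < p) (hQ : IsCompact Q)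
    (hg : Continuous (Function.uncurry g)) (hd : ∀ q, Differentiable ℂ fun w => g w q)
    {M C : ℝ} (hM : 0 < M)
    (hgrow : ∀ w : ℂ, |w.im| ≤ w.re →
      windowMean ν Q p g w ≤ ENNReal.ofReal (C * Real.exp (C * ‖w‖)))
    (hbd : ∀ w : ℂ, |w.im| = w.re → windowMean ν Q p g w ≤ ENNReal.ofReal M) {w : ℂ}
    (hw : |w.im| ≤ w.re) : windowMean ν Q p g w ≤ ENNReal.ofReal M := by
  have hS : IsClosed {w : ℂ | |w.im| ≤ w.re} := isClosed_le (by fun_prop) (by fun_prop)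
  have hΩ : IsOpen {w : ℂ | w + 1 ∈ Complex.slitPlane} :=
    Complex.isOpen_slitPlane.preimage (by fun_prop)
  refine windowMean_le_of_le_frontier hp hQ hg hd hS hΩ ?_ (φ := fun w => (w + 1).sqrt ^ 3)
    ?_ ?_ hM.le ?_ ?_ w hw
  · intro w hw
    have : 0 ≤ w.re := (abs_nonneg _).trans hw
    refine Or.inl ?_
    simp only [Complex.add_re, Complex.one_re]
    linarith
  · refine DifferentiableOn.pow ?_ 3
    exact Complex.differentiableOn_sqrt.comp (by fun_prop) fun w hw => hw
  · intro w hw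
    obtain ⟨h1, -, h4⟩ := re_sqrt_pow_three_ge hw
    exact le_trans (by positivity) h4
  · intro δ hδ
    filter_upwards [eventually_forall_mul_exp_le (C := C) hM hδ] with R hR w hw hwR
    obtain ⟨h1, h3, h4⟩ := re_sqrt_pow_three_ge hw
    refine (hgrow w hw).trans (ENNReal.ofReal_le_ofReal ?_)
    rw [hwR]
    have h5 : R ≤ ‖w + 1‖ := by
      have h0 : 0 ≤ w.re := (abs_nonneg _).trans hw
      rw [← hwR, ← sq_le_sq₀ (norm_nonneg _) (norm_nonneg _), Complex.sq_norm, Complex.sq_norm,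
        Complex.normSq_apply, Complex.normSq_apply]
      simp only [Complex.add_re, Complex.one_re, Complex.add_im, Complex.one_im]
      nlinarith
    refine (hR _ h1 (h5.trans h3)).trans ?_
    gcongr
  · intro w hw hwi
    refine hbd w (le_antisymm hw (not_lt.1 fun hlt => hwi ?_))
    have hopen : IsOpen {w : ℂ | |w.im| < w.re} := isOpen_lt (by fun_prop) (by fun_prop)
    exact interior_maximal (t := {w : ℂ | |w.im| < w.re}) (fun _ => le_of_lt (α := ℝ)) hopen hlt

/-- Phragmén–Lindelöf principle in the upper half-plane, for functions that grow at most
exponentially in `|Re w|`, uniformly in `Im w ≥ 0`. Such a function is bounded on the imaginary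
axis, hence bounded in both quadrants; then the bound on the real axis propagates, with
`log (1 - i w)` as auxiliary exponent. -/
theorem windowMean_le_of_upperHalfPlane (hp : 0 < p) (hQ : IsCompact Q)
    (hg : Continuous (Function.uncurry g)) (hd : ∀ q, Differentiable ℂ fun w => g w q)
    {M C : ℝ} (hM : 0 < M)
    (hgrow : ∀ w : ℂ, 0 ≤ w.im →
      windowMean ν Q p g w ≤ ENNReal.ofReal (C * Real.exp (C * |w.re|)))
    (hbd : ∀ w : ℂ, w.im = 0 → windowMean ν Q p g w ≤ ENNReal.ofReal M) {w : ℂ}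
    (hw : 0 ≤ w.im) : windowMean ν Q p g w ≤ ENNReal.ofReal M := by
  wlog hC : 0 < C generalizing C
  · refine this (C := 1) (fun w hw => (hgrow w hw).trans (ENNReal.ofReal_le_ofReal ?_)) one_pos
    exact (mul_nonpos_of_nonpos_of_nonneg (not_lt.1 hC) (Real.exp_pos _).le).trans (by positivity)
  -- `w ↦ (1 + i) w` and `w ↦ (-1 + i) w` map the sector onto the two quadrants.
  have sector : ∀ a : ℂ, ‖a‖ ≤ 2 →
      (∀ w : ℂ, |w.im| ≤ w.re → 0 ≤ (a * w).im) →
      (∀ w : ℂ, |w.im| = w.re → (a * w).im = 0 ∨ (a * w).re = 0) →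
      ∀ w : ℂ, |w.im| ≤ w.re → windowMean ν Q p g (a * w) ≤ ENNReal.ofReal (max M C) := by
    intro a ha ha1 ha2 w hw
    change windowMean ν Q p (fun w q => g (a * w) q) w ≤ _
    refine windowMean_le_of_sector hp hQ (g := fun w q => g (a * w) q) (C := C * 2) ?_ ?_
      (lt_max_of_lt_left hM) ?_ ?_ hw
    · exact hg.comp (g := Function.uncurry g) (f := fun z : ℂ × X => (a * z.1, z.2)) (by fun_prop)
    · intro q
      exact (hd q).comp (by fun_prop)
    · intro w hw
      change windowMean ν Q p g (a * w) ≤ _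
      refine (hgrow _ (ha1 w hw)).trans (ENNReal.ofReal_le_ofReal ?_)
      have h1 : |(a * w).re| ≤ 2 * ‖w‖ := by
        refine (Complex.abs_re_le_norm _).trans ?_
        rw [norm_mul]
        gcongr
      calc C * Real.exp (C * |(a * w).re|) ≤ C * Real.exp (C * (2 * ‖w‖)) := by gcongr
        _ ≤ C * 2 * Real.exp (C * 2 * ‖w‖) := by
          rw [mul_assoc C 2 ‖w‖, mul_right_comm]
          linarith [mul_pos hC (Real.exp_pos (C * (2 * ‖w‖)))]
    · intro w hw
      change windowMean ν Q p g (a * w) ≤ _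
      rcases ha2 w hw with h | h
      · exact (hbd _ h).trans (ENNReal.ofReal_le_ofReal (le_max_left _ _))
      · refine (hgrow _ (ha1 w hw.le)).trans (ENNReal.ofReal_le_ofReal ?_)
        simp [h]
  have hbound : ∀ w : ℂ, 0 ≤ w.im → windowMean ν Q p g w ≤ ENNReal.ofReal (max M C) := by
    intro w hw
    rcases le_total 0 w.re with h0 | h0
    · have e : w = (1 + Complex.I) * (⟨(w.re + w.im) / 2, (w.im - w.re) / 2⟩ : ℂ) := by
        apply Complex.ext <;> simp <;> ring
      rw [e]
      refine sector _ ?_ ?_ ?_ _ ?_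
      · exact (norm_add_le _ _).trans (by simp; norm_num)
      · intro z hz
        have := abs_le.1 hz
        simp; linarith
      · intro z hz
        rcases abs_cases z.im with h | h
        · right; simp; linarith
        · left; simp; linarith
      · simp only [abs_le]; constructor <;> linarith
    · have e : w = (-1 + Complex.I) * (⟨(w.im - w.re) / 2, -(w.im + w.re) / 2⟩ : ℂ) := by
        apply Complex.ext <;> simp <;> ring
      rw [e]
      refine sector _ ?_ ?_ ?_ _ ?_
      · exact (norm_add_le _ _).trans (by simp; norm_num)
      · intro z hz
        have := abs_le.1 hz
        simp; linarith
      · intro z hz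
        rcases abs_cases z.im with h | h
        · left; simp; linarith
        · right; simp; linarith
      · simp only [abs_le]; constructor <;> linarith
  have hS : IsClosed {w : ℂ | 0 ≤ w.im} := isClosed_le (by fun_prop) (by fun_prop)
  have hΩ : IsOpen {w : ℂ | 1 - Complex.I * w ∈ Complex.slitPlane} :=
    Complex.isOpen_slitPlane.preimage (by fun_prop)
  have hnorm : ∀ w : ℂ, 0 ≤ w.im → 1 ≤ ‖1 - Complex.I * w‖ := by
    intro w hw
    have := Complex.re_le_norm (1 - Complex.I * w)
    simp at this
    linarith
  refine windowMean_le_of_le_frontier hp hQ hg hd hS hΩ ?_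
    (φ := fun w => Complex.log (1 - Complex.I * w)) ?_ ?_ hM.le ?_ ?_ w hw
  · intro w hw
    refine Or.inl ?_
    have : 0 ≤ w.im := hw
    simp; linarith
  · exact DifferentiableOn.clog (by fun_prop) fun w hw => hw
  · intro w hw
    rw [Complex.log_re]
    exact Real.log_nonneg (hnorm w hw)
  · intro δ hδ
    have hlim : Tendsto (fun R : ℝ => M * Real.exp (δ * Real.log (R - 1))) atTop atTop := by
      refine Tendsto.const_mul_atTop hM (Real.tendsto_exp_atTop.comp ?_)
      refine Tendsto.const_mul_atTop hδ (Real.tendsto_log_atTop.comp ?_)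
      exact tendsto_atTop_add_const_right _ _ tendsto_id
    filter_upwards [hlim.eventually_ge_atTop (max M C), eventually_gt_atTop 1]
      with R hR hR1 w hw hwR
    refine (hbound w hw).trans (ENNReal.ofReal_le_ofReal (hR.trans ?_))
    rw [Complex.log_re]
    have : R - 1 ≤ ‖1 - Complex.I * w‖ := by
      have := norm_sub_norm_le (Complex.I * w) 1
      rw [norm_sub_rev] at this
      simpa [hwR] using this
    have h0 : 0 < R - 1 := by linarith
    gcongr
  · intro w hw hwi
    refine hbd w (le_antisymm (not_lt.1 fun hlt => hwi ?_) hw)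
    have hopen : IsOpen {w : ℂ | 0 < w.im} := isOpen_lt (by fun_prop) (by fun_prop)
    exact interior_maximal (t := {w : ℂ | 0 < w.im}) (fun _ => le_of_lt (α := ℝ)) hopen hlt

end WindowMean

/-! ### The complexification as a topological vector space -/

namespace Complexification

theorem norm_re_le {F : Type*} [NormedAddCommGroup F] (z : Complexification F) :
    ‖z.re‖ ≤ ‖z‖ := by
  rw [← sq_le_sq₀ (norm_nonneg _) (norm_nonneg _), norm_sq_eq]
  nlinarith [sq_nonneg ‖z.im‖]

theorem norm_im_le {F : Type*} [NormedAddCommGroup F] (z : Complexification F) :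
    ‖z.im‖ ≤ ‖z‖ := by
  rw [← sq_le_sq₀ (norm_nonneg _) (norm_nonneg _), norm_sq_eq]
  nlinarith [sq_nonneg ‖z.re‖]

theorem norm_le_add {F : Type*} [NormedAddCommGroup F] (z : Complexification F) :
    ‖z‖ ≤ ‖z.re‖ + ‖z.im‖ := by
  have : 0 ≤ ‖z.re‖ * ‖z.im‖ := by positivity
  rw [← sq_le_sq₀ (norm_nonneg _) (by positivity), norm_sq_eq]
  nlinarith

variable {F : Type*} [NormedAddCommGroup F] [InnerProductSpace ℝ F]

theorem re_real_smul (r : ℝ) (z : Complexification F) : (r • z).re = r • z.re := by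
  rw [← Complex.coe_smul, re_smul]; simp

theorem im_real_smul (r : ℝ) (z : Complexification F) : (r • z).im = r • z.im := by
  rw [← Complex.coe_smul, im_smul]; simp

/-- The real-linear identification of `F × F` with `F_ℂ`, `(x, y) ↦ x + i y`. -/
def mkLinearEquiv : (F × F) ≃ₗ[ℝ] Complexification F where
  toFun v := mk v.1 v.2
  invFun z := (z.re, z.im)
  map_add' v w := by ext <;> simp
  map_smul' r v := by ext <;> simp [re_real_smul, im_real_smul]
  left_inv v := by simp
  right_inv z := by ext <;> simp

/-- `mkLinearEquiv` as a homeomorphism. -/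
def mkContinuousLinearEquiv : (F × F) ≃L[ℝ] Complexification F where
  toLinearEquiv := mkLinearEquiv
  continuous_toFun := by
    refine AddMonoidHomClass.continuous_of_bound (mkLinearEquiv (F := F)) 2 fun v => ?_
    refine (norm_le_add _).trans ?_
    have h1 := norm_fst_le v
    have h2 := norm_snd_le v
    change ‖v.1‖ + ‖v.2‖ ≤ _
    linarith
  continuous_invFun := by
    refine AddMonoidHomClass.continuous_of_bound (mkLinearEquiv (F := F)).symm 1 fun z => ?_
    rw [one_mul]
    exact max_le (norm_re_le z) (norm_im_le z)

theorem continuous_mk : Continuous fun v : F × F => mk v.1 v.2 :=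
  mkContinuousLinearEquiv.continuous

theorem continuous_re : Continuous (re : Complexification F → F) :=
  continuous_fst.comp (mkContinuousLinearEquiv (F := F)).symm.continuous

theorem continuous_im : Continuous (im : Complexification F → F) :=
  continuous_snd.comp (mkContinuousLinearEquiv (F := F)).symm.continuous

theorem finiteDimensional [FiniteDimensional ℝ F] : FiniteDimensional ℂ (Complexification F) :=
  have : FiniteDimensional ℝ (Complexification F) :=
    (mkLinearEquiv (F := F)).finiteDimensional
  Module.Finite.of_restrictScalars_finite ℝ ℂ _

end Complexification

open Complexification

/-! ### The supporting function -/

section SupportFunction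

variable {F : Type*} [NormedAddCommGroup F] [InnerProductSpace ℝ F]
  {K : Set (StrongDual ℝ F)}

/-- The supporting function of `K` as a real number; this is a junk value unless `suppFun K h` is
finite, which holds for non-empty compact `K` (see `coe_realSupp`). -/
noncomputable def realSupp (K : Set (StrongDual ℝ F)) (h : F) : ℝ := (suppFun K h).toReal

theorem exists_suppFun_eq (hK : IsCompact K) (hne : K.Nonempty) (h : F) :
    ∃ l ∈ K, (∀ l' ∈ K, -l' h ≤ -l h) ∧ suppFun K h = ((-l h : ℝ) : EReal) := by
  obtain ⟨l, hl, hmax⟩ := hK.exists_isMaxOn (f := fun l : StrongDual ℝ F => -l h) hne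
    (by fun_prop)
  refine ⟨l, hl, fun l' hl' => hmax hl', le_antisymm ?_ ?_⟩
  · refine iSup₂_le fun l' hl' => ?_
    have h1 : -(-l') h ≤ -l h := hmax (Set.mem_neg.1 hl')
    rw [neg_apply, neg_neg] at h1
    exact EReal.coe_le_coe_iff.2 h1
  · have : -l ∈ -K := by simpa using hl
    exact le_iSup₂ (f := fun (l : StrongDual ℝ F) (_ : l ∈ -K) => ((l h : ℝ) : EReal)) (-l) this

theorem coe_realSupp (hK : IsCompact K) (hne : K.Nonempty) (h : F) :
    suppFun K h = (realSupp K h : EReal) := by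
  obtain ⟨l, -, -, e⟩ := exists_suppFun_eq hK hne h
  rw [realSupp, e, EReal.toReal_coe]

theorem exists_realSupp_eq (hK : IsCompact K) (hne : K.Nonempty) (h : F) :
    ∃ l ∈ K, realSupp K h = -l h := by
  obtain ⟨l, hl, -, e⟩ := exists_suppFun_eq hK hne h
  exact ⟨l, hl, by rw [realSupp, e, EReal.toReal_coe]⟩

theorem neg_apply_le_realSupp (hK : IsCompact K) {l : StrongDual ℝ F} (hl : l ∈ K) (h : F) :
    -l h ≤ realSupp K h := by
  obtain ⟨l', -, hmax, e⟩ := exists_suppFun_eq hK ⟨l, hl⟩ h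
  rw [realSupp, e, EReal.toReal_coe]
  exact hmax l hl

theorem realSupp_add_le (hK : IsCompact K) (hne : K.Nonempty) {R : ℝ} (hR : ∀ l ∈ K, ‖l‖ ≤ R)
    (h h' : F) : realSupp K (h + h') ≤ realSupp K h + R * ‖h'‖ := by
  obtain ⟨l, hl, e⟩ := exists_realSupp_eq hK hne (h + h')
  have h1 := neg_apply_le_realSupp hK hl h
  have h2 : -l h' ≤ R * ‖h'‖ :=
    (neg_le_abs _).trans ((l.le_opNorm h').trans (by gcongr; exact hR l hl))
  rw [e, map_add]
  linarith

theorem realSupp_smul (hK : IsCompact K) (hne : K.Nonempty) {t : ℝ} (ht : 0 ≤ t) (h : F) :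
    realSupp K (t • h) = t * realSupp K h := by
  refine le_antisymm ?_ ?_
  · obtain ⟨l, hl, e⟩ := exists_realSupp_eq hK hne (t • h)
    rw [e, map_smul, smul_eq_mul, ← mul_neg]
    exact mul_le_mul_of_nonneg_left (neg_apply_le_realSupp hK hl h) ht
  · obtain ⟨l, hl, e⟩ := exists_realSupp_eq hK hne h
    have := neg_apply_le_realSupp hK hl (t • h)
    rwa [map_smul, smul_eq_mul, ← mul_neg, ← e] at this

theorem suppFun_add_closedBall_le (hK : IsCompact K) {ε : ℝ} (h : F) :
    suppFun (K + Metric.closedBall 0 ε) h ≤ ((realSupp K h + ε * ‖h‖ : ℝ) : EReal) := by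
  refine iSup₂_le fun l hl => ?_
  obtain ⟨l₁, h₁, l₂, h₂, e⟩ := Set.mem_add.1 (Set.mem_neg.1 hl)
  have e' : l h = -l₁ h + -l₂ h := by
    have := congrArg (fun l : StrongDual ℝ F => -l h) e
    simp only [add_apply, neg_apply, neg_neg] at this
    linarith
  have h3 : ‖l₂‖ ≤ ε := by simpa using h₂
  have h4 : -l₂ h ≤ ε * ‖h‖ :=
    (neg_le_abs _).trans ((l₂.le_opNorm h).trans (by gcongr))
  rw [EReal.coe_le_coe_iff, e']
  linarith [neg_apply_le_realSupp hK h₁ h]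

theorem suppFun_empty (h : F) : suppFun (∅ : Set (StrongDual ℝ F)) h = ⊥ := by
  simp [suppFun]

end SupportFunction

/-! ### Slices and restrictions to complex lines -/

section Slices

variable {E F : Type*} [NormedAddCommGroup E] [InnerProductSpace ℂ E]
  [NormedAddCommGroup F] [InnerProductSpace ℝ F]
  {Φ : E →ₗ[ℂ] E →ₗ⋆[ℂ] Complexification F} {K : Set (StrongDual ℝ F)}
  {f : E × Complexification F → ℂ}

theorem exists_norm_sesq_le [FiniteDimensional ℂ E] (Φ : E →ₗ[ℂ] E →ₗ⋆[ℂ] Complexification F) :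
    ∃ c : ℝ, 0 ≤ c ∧ ∀ ζ ζ' : E, ‖Φ ζ ζ'‖ ≤ c * ‖ζ‖ * ‖ζ'‖ := by
  let b := stdOrthonormalBasis ℂ E
  refine ⟨∑ i, ∑ j, ‖Φ (b i) (b j)‖, by positivity, fun ζ ζ' => ?_⟩
  have e : Φ ζ ζ' = ∑ i, ∑ j, inner ℂ (b i) ζ • (starRingEnd ℂ (inner ℂ (b j) ζ')) •
      Φ (b i) (b j) := by
    conv_lhs => rw [← b.sum_repr' ζ, ← b.sum_repr' ζ']
    simp only [map_sum, LinearMap.sum_apply, map_smul, LinearMap.smul_apply, map_smulₛₗ,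
      Finset.smul_sum]
    rw [Finset.sum_comm]
    refine Finset.sum_congr rfl fun i _ => Finset.sum_congr rfl fun j _ => ?_
    rw [smul_comm]
  rw [e, Finset.sum_mul, Finset.sum_mul]
  refine (norm_sum_le _ _).trans (Finset.sum_le_sum fun i _ => ?_)
  rw [Finset.sum_mul, Finset.sum_mul]
  refine (norm_sum_le _ _).trans (Finset.sum_le_sum fun j _ => ?_)
  rw [norm_smul, norm_smul, RCLike.norm_conj]
  have h1 : ‖inner ℂ (b i) ζ‖ ≤ ‖ζ‖ := by
    simpa using norm_inner_le_norm (𝕜 := ℂ) (b i) ζ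
  have h2 : ‖inner ℂ (b j) ζ'‖ ≤ ‖ζ'‖ := by
    simpa using norm_inner_le_norm (𝕜 := ℂ) (b j) ζ'
  calc ‖inner ℂ (b i) ζ‖ * (‖inner ℂ (b j) ζ'‖ * ‖Φ (b i) (b j)‖)
      ≤ ‖ζ‖ * (‖ζ'‖ * ‖Φ (b i) (b j)‖) := by gcongr
    _ = _ := by ring

theorem continuous_sesq [FiniteDimensional ℂ E] (Φ : E →ₗ[ℂ] E →ₗ⋆[ℂ] Complexification F) :
    Continuous fun v : E × E => Φ v.1 v.2 := by
  obtain ⟨c, -, hc⟩ := exists_norm_sesq_le Φ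
  let B : E →ₗ[ℝ] E →ₗ[ℝ] Complexification F := LinearMap.mk₂ ℝ (fun a b => Φ a b)
    (fun a a' b => by simp) (fun r a b => by simp [← Complex.coe_smul])
    (fun a b b' => by simp) (fun r a b => by simp [← Complex.coe_smul])
  exact (B.mkContinuous₂ c hc).continuous₂

theorem continuous_quadPart [FiniteDimensional ℂ E] (Φ : E →ₗ[ℂ] E →ₗ⋆[ℂ] Complexification F) :
    Continuous (quadPart Φ) :=
  continuous_re.comp ((continuous_sesq Φ).comp (continuous_id.prodMk continuous_id))

theorem continuous_slice [FiniteDimensional ℂ E] (hf : Continuous f) :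
    Continuous fun v : (E × F) × F => slice Φ f v.2 v.1 := by
  have h1 := continuous_quadPart Φ
  refine hf.comp (Continuous.prodMk (by fun_prop) ?_)
  exact continuous_mk.comp (Continuous.prodMk (f := fun v : (E × F) × F => v.1.2)
    (g := fun v : (E × F) × F => quadPart Φ v.1.1 + v.2) (by fun_prop) (by fun_prop))

/-- The defining estimate of `expTypeSpace`, in terms of slices and real numbers. -/
theorem exists_norm_le_of_mem_expTypeSpace (hK : IsCompact K) (hf : f ∈ expTypeSpace Φ K) {ε : ℝ}
    (hε : 0 < ε) : ∃ C : ℝ, 0 < C ∧ ∀ h v, ‖slice Φ f h v‖ ≤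
      C * Real.exp (C * (‖v.1‖ ^ 2 + ‖v.2‖) + realSupp K h + ε * ‖h‖) := by
  obtain ⟨C, hC, hb⟩ := hf.2 ε hε
  refine ⟨C, hC, fun h v => ?_⟩
  have h1 := hb v.1 (mk v.2 (quadPart Φ v.1 + h))
  have e : rho Φ (v.1, mk v.2 (quadPart Φ v.1 + h)) = h := by simp [rho]
  rw [e] at h1
  have h2 := h1.trans (mul_le_mul_right (EReal.exp_monotone
    (add_le_add_right (suppFun_add_closedBall_le hK (ε := ε) h) _)) _)
  rw [← EReal.coe_add, EReal.exp_coe, ← ENNReal.ofReal_mul hC.le, ← ofReal_norm,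
    ENNReal.ofReal_le_ofReal_iff (by positivity)] at h2
  simpa [slice, add_assoc] using h2

theorem eq_zero_of_mem_expTypeSpace_empty (hf : f ∈ expTypeSpace Φ ∅) : f = 0 := by
  obtain ⟨C, hC, hb⟩ := hf.2 1 one_pos
  funext w
  have := hb w.1 w.2
  simpa [suppFun_empty] using this

/-- The restriction of `f` to the complex line with direction `h` through the point
`(ζ, x + iΦ(ζ))`, where `v = (ζ, x)`; the parameter on the line is `w`. -/
noncomputable def lineRestriction (Φ : E →ₗ[ℂ] E →ₗ⋆[ℂ] Complexification F)
    (f : E × Complexification F → ℂ)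
    (h : F) (w : ℂ) (v : E × F) : ℂ :=
  f (v.1, mk v.2 (quadPart Φ v.1) + w • mk h 0)

theorem lineRestriction_eq_slice (h : F) (w : ℂ) (v : E × F) :
    lineRestriction Φ f h w v = slice Φ f (w.im • h) (v + (0, w.re • h)) := by
  unfold lineRestriction slice
  congr 2
  · simp
  · ext <;> simp

theorem continuous_lineRestriction [FiniteDimensional ℂ E] (hf : Continuous f) (h : F) :
    Continuous (Function.uncurry (lineRestriction Φ f h)) := by
  have : Function.uncurry (lineRestriction Φ f h) =
      (fun v : (E × F) × F => slice Φ f v.2 v.1) ∘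
        fun v : ℂ × (E × F) => (v.2 + (0, v.1.re • h), v.1.im • h) := by
    funext v
    exact lineRestriction_eq_slice h v.1 v.2
  rw [this]
  refine (continuous_slice hf).comp ?_
  have h1 := Complex.continuous_re
  have h2 := Complex.continuous_im
  fun_prop

theorem differentiable_lineRestriction (hf : Differentiable ℂ f) (h : F) (v : E × F) :
    Differentiable ℂ fun w => lineRestriction Φ f h w v :=
  hf.comp (by fun_prop)

end Slices

/-! ### The Plancherel–Pólya inequality and decay of local means -/

section PlancherelPolya

variable {E F : Type*} [NormedAddCommGroup E] [InnerProductSpace ℂ E]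
  [NormedAddCommGroup F] [InnerProductSpace ℝ F]
  {Φ : E →ₗ[ℂ] E →ₗ⋆[ℂ] Complexification F} {K : Set (StrongDual ℝ F)}
  {f : E × Complexification F → ℂ} {p : ℝ}

theorem enorm_cexp_mul_I_mul_rpow (hp : 0 < p) (κ : ℝ) (w : ℂ) :
    ‖Complex.exp (κ * Complex.I * w)‖ₑ ^ p = ENNReal.ofReal (Real.exp (-(p * (κ * w.im)))) := by
  rw [enorm_rpow_eq_ofReal hp, Complex.norm_exp, ← Real.exp_mul]
  congr 2
  simp
  ring

theorem windowMean_cexp_mul_lineRestriction [MeasurableSpace E] [MeasurableSpace F]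
    (ν : Measure (E × F)) (Q : Set (E × F)) (hp : 0 < p) (κ : ℝ) (h : F) (w : ℂ) :
    windowMean ν Q p (fun w q => Complex.exp (κ * Complex.I * w) * lineRestriction Φ f h w q) w =
      ENNReal.ofReal (Real.exp (-(p * (κ * w.im)))) *
        ∫⁻ v in Q, ‖slice Φ f (w.im • h) (v + (0, w.re • h))‖ₑ ^ p ∂ν := by
  have e := enorm_cexp_mul_I_mul_rpow hp κ w
  rw [windowMean, ← e, ← lintegral_const_mul' _ _ (by rw [e]; exact ENNReal.ofReal_ne_top)]
  refine lintegral_congr fun v => ?_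
  rw [enorm_mul, ENNReal.mul_rpow_of_nonneg _ _ hp.le, lineRestriction_eq_slice]

variable [FiniteDimensional ℂ E] [MeasurableSpace E] [BorelSpace E] [FiniteDimensional ℝ F]
  [MeasurableSpace F] [BorelSpace F] {μ : Measure (E × F)} [μ.IsAddHaarMeasure]

/-- Approximate Plancherel–Pólya inequality on a window. On every complex line with direction `h`
multiply `f` by `exp (i κ w)`, where `κ` slightly exceeds `H_K(h)`: this compensates the growth in
`Im w ≥ 0`, so that `windowMean_le_of_upperHalfPlane` applies. -/
theorem setLIntegral_slice_le (hp : 0 < p) (hK : IsCompact K) (hne : K.Nonempty)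
    (hf : f ∈ expTypeSpace Φ K) (h : F) {Q : Set (E × F)} (hQ : IsCompact Q) {η : ℝ} (hη : 0 < η)
    (hA : ∫⁻ v, ‖slice Φ f 0 v‖ₑ ^ p ∂μ ≠ ∞) :
    ∫⁻ v in Q, ‖slice Φ f h v‖ₑ ^ p ∂μ ≤ ENNReal.ofReal (Real.exp (p * (realSupp K h + η))) *
      ENNReal.ofReal ((∫⁻ v, ‖slice Φ f 0 v‖ₑ ^ p ∂μ).toReal + η) := by
  have : ProperSpace E := FiniteDimensional.proper ℂ E
  set A := ∫⁻ v, ‖slice Φ f 0 v‖ₑ ^ p ∂μ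
  set κ : ℝ := realSupp K h + η with hκ
  obtain ⟨C, hC, hb⟩ := exists_norm_le_of_mem_expTypeSpace (Φ := Φ) hK hf
    (ε := η / (‖h‖ + 1)) (by positivity)
  have hηh : η / (‖h‖ + 1) * ‖h‖ ≤ η := by
    rw [div_mul_eq_mul_div, div_le_iff₀ (by positivity)]
    nlinarith
  obtain ⟨B, hB0, hB⟩ := hQ.isBounded.exists_pos_norm_le
  have hcont : Continuous (Function.uncurry fun (w : ℂ) (q : E × F) =>
      Complex.exp (κ * Complex.I * w) * lineRestriction Φ f h w q) := by
    have h1 := continuous_lineRestriction (Φ := Φ) hf.1.continuous h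
    refine Continuous.mul (f := fun v : ℂ × E × F => Complex.exp (κ * Complex.I * v.1))
      (g := Function.uncurry (lineRestriction Φ f h)) (by fun_prop) h1
  have hQfin : μ Q ≠ ∞ := hQ.measure_lt_top.ne
  have hgrow : ∀ w : ℂ, 0 ≤ w.im → ∀ v ∈ Q,
      Real.exp (-(κ * w.im)) * ‖slice Φ f (w.im • h) (v + (0, w.re • h))‖ ≤
        C * Real.exp (C * (B ^ 2 + B)) * Real.exp (C * ‖h‖ * |w.re|) := by
    intro w hw v hv
    have h1 := hb (w.im • h) (v + (0, w.re • h))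
    have h2 : ‖(v + (0, w.re • h)).1‖ ≤ B := by
      simpa using (norm_fst_le v).trans (hB v hv)
    have h3 : ‖(v + (0, w.re • h)).2‖ ≤ B + |w.re| * ‖h‖ := by
      refine (norm_add_le _ _).trans ?_
      rw [norm_smul, Real.norm_eq_abs]
      gcongr
      exact (norm_snd_le v).trans (hB v hv)
    rw [realSupp_smul hK hne hw, norm_smul, Real.norm_of_nonneg hw] at h1
    calc _ ≤ Real.exp (-(κ * w.im)) * (C * Real.exp (C * (B ^ 2 + (B + |w.re| * ‖h‖)) +
          w.im * realSupp K h + η / (‖h‖ + 1) * (w.im * ‖h‖))) := by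
          refine mul_le_mul_of_nonneg_left (h1.trans ?_) (Real.exp_pos _).le
          gcongr
      _ = C * Real.exp (C * (B ^ 2 + B) + C * ‖h‖ * |w.re| +
          w.im * (η / (‖h‖ + 1) * ‖h‖ - η)) := by
          rw [mul_left_comm, ← Real.exp_add, hκ]
          ring_nf
      _ ≤ C * Real.exp (C * (B ^ 2 + B) + C * ‖h‖ * |w.re|) := by
          have : w.im * (η / (‖h‖ + 1) * ‖h‖ - η) ≤ 0 :=
            mul_nonpos_of_nonneg_of_nonpos hw (by linarith)
          exact mul_le_mul_of_nonneg_left (Real.exp_le_exp.2 (by linarith)) hC.le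
      _ = _ := by rw [Real.exp_add]; ring
  set C₁ : ℝ := (C * Real.exp (C * (B ^ 2 + B))) ^ p * (μ Q).toReal
  have hC₁ : 0 ≤ C₁ := by positivity
  have hA0 : 0 ≤ A.toReal := ENNReal.toReal_nonneg
  have key := windowMean_le_of_upperHalfPlane (ν := μ) hp hQ hcont (fun q => ?_)
    (M := A.toReal + η) (C := max C₁ (C * ‖h‖ * p)) (by linarith) ?_ ?_
    (w := Complex.I) (by simp)
  · rw [windowMean_cexp_mul_lineRestriction μ Q hp] at key
    have h2 := mul_le_mul_right key (ENNReal.ofReal (Real.exp (p * κ)))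
    rw [← mul_assoc, ← ENNReal.ofReal_mul (Real.exp_pos _).le, ← Real.exp_add] at h2
    simpa [Prod.mk_zero_zero] using h2
  · have h1 := differentiable_lineRestriction (Φ := Φ) hf.1 h q
    exact Differentiable.mul (by fun_prop) h1
  · intro w hw
    rw [windowMean_cexp_mul_lineRestriction μ Q hp,
      ← lintegral_const_mul' _ _ ENNReal.ofReal_ne_top]
    have hpt : ∀ v ∈ Q, ENNReal.ofReal (Real.exp (-(p * (κ * w.im)))) *
        ‖slice Φ f (w.im • h) (v + (0, w.re • h))‖ₑ ^ p ≤
        ENNReal.ofReal ((C * Real.exp (C * (B ^ 2 + B))) ^ p *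
          Real.exp (C * ‖h‖ * p * |w.re|)) := by
      intro v hv
      rw [enorm_rpow_eq_ofReal hp, ← ENNReal.ofReal_mul (Real.exp_pos _).le]
      refine ENNReal.ofReal_le_ofReal ?_
      have h1 := Real.rpow_le_rpow (by positivity) (hgrow w hw v hv) hp.le
      rw [Real.mul_rpow (by positivity) (by positivity), Real.mul_rpow (by positivity)
        (by positivity), ← Real.exp_mul, ← Real.exp_mul] at h1
      convert h1 using 3 <;> ring
    refine (setLIntegral_mono' hQ.measurableSet hpt).trans ?_
    rw [setLIntegral_const, ← ENNReal.ofReal_toReal hQfin, ← ENNReal.ofReal_mul (by positivity)]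
    refine ENNReal.ofReal_le_ofReal ?_
    rw [mul_right_comm]
    change C₁ * _ ≤ _
    gcongr
    · exact le_max_left _ _
    · exact le_max_right _ _
  · intro w hw
    rw [windowMean_cexp_mul_lineRestriction μ Q hp, hw]
    simp only [zero_smul, mul_zero, neg_zero, Real.exp_zero, ENNReal.ofReal_one, one_mul]
    refine (setLIntegral_le_lintegral _ _).trans ?_
    rw [lintegral_add_right_eq_self (fun v => ‖slice Φ f 0 v‖ₑ ^ p)]
    change A ≤ _
    rw [← ENNReal.ofReal_toReal hA]
    exact ENNReal.ofReal_le_ofReal (by simp [hη.le])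

/-- **Plancherel–Pólya inequality** for the slices, valid for every exponent `p > 0`. -/
theorem lintegral_slice_le (hp : 0 < p) (hK : IsCompact K) (hne : K.Nonempty)
    (hf : f ∈ expTypeSpace Φ K) (h : F) :
    ∫⁻ v, ‖slice Φ f h v‖ₑ ^ p ∂μ ≤ ENNReal.ofReal (Real.exp (p * realSupp K h)) *
      ∫⁻ v, ‖slice Φ f 0 v‖ₑ ^ p ∂μ := by
  have : ProperSpace E := FiniteDimensional.proper ℂ E
  by_cases hA : ∫⁻ v, ‖slice Φ f 0 v‖ₑ ^ p ∂μ = ∞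
  · rw [hA, ENNReal.mul_top (by simp [Real.exp_pos])]
    exact le_top
  set A := ∫⁻ v, ‖slice Φ f 0 v‖ₑ ^ p ∂μ with hAdef
  have hwin : ∀ Q : Set (E × F), IsCompact Q → ∫⁻ v in Q, ‖slice Φ f h v‖ₑ ^ p ∂μ ≤
      ENNReal.ofReal (Real.exp (p * realSupp K h)) * A := by
    intro Q hQ
    have hlim : Tendsto (fun η : ℝ => ENNReal.ofReal (Real.exp (p * (realSupp K h + η)) *
        (A.toReal + η))) (𝓝[>] 0)
        (𝓝 (ENNReal.ofReal (Real.exp (p * realSupp K h)) * A)) := by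
      have hc : Continuous fun η : ℝ => ENNReal.ofReal (Real.exp (p * (realSupp K h + η)) *
        (A.toReal + η)) := ENNReal.continuous_ofReal.comp (by fun_prop)
      have h0 := hc.tendsto 0
      rw [add_zero, add_zero, ENNReal.ofReal_mul (Real.exp_pos _).le,
        ENNReal.ofReal_toReal hA] at h0
      exact h0.mono_left nhdsWithin_le_nhds
    refine ge_of_tendsto hlim (eventually_nhdsWithin_of_forall fun η hη => ?_)
    rw [ENNReal.ofReal_mul (Real.exp_pos _).le]
    exact setLIntegral_slice_le hp hK hne hf h hQ hη hA
  have hmeas : Measurable fun v => ‖slice Φ f h v‖ₑ ^ p := by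
    have : Continuous (slice Φ f h) :=
      (continuous_slice (Φ := Φ) hf.1.continuous).comp (Continuous.prodMk_left h)
    exact this.measurable.enorm.pow_const p
  have hcover : AECover μ atTop fun n : ℕ => Metric.closedBall (0 : E × F) n :=
    aecover_closedBall tendsto_natCast_atTop_atTop
  exact le_of_tendsto' (hcover.lintegral_tendsto_of_countably_generated hmeas.aemeasurable)
    fun n => hwin _ (isCompact_closedBall _ _)

/-- Decay of local means in `h`. Suppose that the lines with direction `(0, h)` meet the window
`Q` in sets of parameters of measure at most `D` (so that `D` is of order `1 / ‖h‖` for a ball `Q`). Then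
the integral of `|f_h| ^ p` over `Q`, moved by a measure preserving `σ` that commutes with the
translations by `(0, x)`, gains the factor `D` over the Plancherel–Pólya inequality. -/
theorem setLIntegral_slice_comp_le (hp : 0 < p) (hK : IsCompact K) (hne : K.Nonempty) :
    ∃ c : ℝ, 0 < c ∧ ∀ f ∈ expTypeSpace Φ K, ∀ h : F, ∀ σ : E × F → E × F, Continuous σ →
      MeasurePreserving σ μ μ → (∀ v x, σ (v + (0, x)) = σ v + (0, x)) →
      ∀ Q : Set (E × F), MeasurableSet Q → ∀ D : ℝ≥0∞,
      (∀ v, volume {s : ℝ | v - (0, s • h) ∈ Q} ≤ D) →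
      ∫⁻ v in Q, ‖slice Φ f h (σ v)‖ₑ ^ p ∂μ ≤
        ENNReal.ofReal (c * Real.exp (p * realSupp K h)) * D *
          ∫⁻ v, ‖slice Φ f 0 v‖ₑ ^ p ∂μ := by
  have : ProperSpace E := FiniteDimensional.proper ℂ E
  set β : ℝ≥0∞ := volume (Metric.closedBall (0 : ℂ) (1 / 2)) with hβ
  have hβ0 : β ≠ 0 := (Metric.measure_closedBall_pos volume _ (by norm_num)).ne'
  have hβt : β ≠ ∞ := (isCompact_closedBall (0 : ℂ) (1 / 2)).measure_lt_top.ne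
  refine ⟨β.toReal⁻¹, inv_pos.2 (ENNReal.toReal_pos hβ0 hβt), ?_⟩
  intro f hf h σ hσ hσμ hσadd Q hQ D hD
  set A := ∫⁻ v, ‖slice Φ f 0 v‖ₑ ^ p ∂μ with hA
  set κ := realSupp K h with hκ
  have hslice : Continuous fun v : (E × F) × F => slice Φ f v.2 v.1 :=
    continuous_slice hf.1.continuous
  have hslice' : ∀ h, Measurable fun v => ‖slice Φ f h v‖ₑ ^ p := fun h => by
    have : Continuous (slice Φ f h) := hslice.comp (Continuous.prodMk_left h)
    exact this.measurable.enorm.pow_const p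
  let W : ℝ → ℝ → ℝ≥0∞ := fun s t => ENNReal.ofReal (Real.exp (-(p * (κ * t)))) *
    ∫⁻ v in Q, ‖slice Φ f (t • h) (σ v + (0, s • h))‖ₑ ^ p ∂μ
  -- Integrating over a horizontal line counts every point of `𝒩` with multiplicity at most `D`.
  have hline : ∀ t : ℝ, 0 ≤ t → ∫⁻ s : ℝ, W s t ≤ D * A := by
    intro t ht
    have h1 : ∀ s : ℝ, ∫⁻ v in Q, ‖slice Φ f (t • h) (σ v + (0, s • h))‖ₑ ^ p ∂μ =
        ∫⁻ v, Q.indicator 1 (v - (0, s • h)) * ‖slice Φ f (t • h) (σ v)‖ₑ ^ p ∂μ := by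
      intro s
      rw [← lintegral_indicator hQ, ← lintegral_sub_right_eq_self _ ((0 : E), s • h)]
      refine lintegral_congr fun v => ?_
      by_cases hv : v - (0, s • h) ∈ Q
      · simp only [Set.indicator_of_mem hv, ← hσadd, sub_add_cancel, Pi.one_apply, one_mul]
      · simp only [Set.indicator_of_notMem hv, zero_mul]
    have h2 : ∫⁻ s : ℝ, ∫⁻ v, Q.indicator 1 (v - (0, s • h)) *
        ‖slice Φ f (t • h) (σ v)‖ₑ ^ p ∂μ ≤
        D * (ENNReal.ofReal (Real.exp (p * (t * κ))) * A) := by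
      rw [lintegral_lintegral_swap]
      · calc _ ≤ ∫⁻ v, D * ‖slice Φ f (t • h) (σ v)‖ₑ ^ p ∂μ := by
              refine lintegral_mono fun v => ?_
              have hm : MeasurableSet {s : ℝ | v - (0, s • h) ∈ Q} :=
                hQ.preimage (f := fun s : ℝ => v - (0, s • h)) (by fun_prop)
              have e : ∀ s : ℝ, Q.indicator (1 : E × F → ℝ≥0∞) (v - (0, s • h)) =
                  {s : ℝ | v - (0, s • h) ∈ Q}.indicator 1 s := fun s => rfl
              simp_rw [e]
              rw [lintegral_mul_const _ (measurable_one.indicator hm), lintegral_indicator_one hm]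
              exact mul_le_mul_left (hD v) _
          _ = D * ∫⁻ v, ‖slice Φ f (t • h) v‖ₑ ^ p ∂μ := by
              rw [← hσμ.lintegral_comp (hslice' _)]
              exact lintegral_const_mul D ((hslice' (t • h)).comp hσ.measurable)
          _ ≤ _ := by
              gcongr
              rw [hκ, ← realSupp_smul hK hne ht]
              exact lintegral_slice_le hp hK hne hf _
      · refine Measurable.aemeasurable ?_
        refine Measurable.mul ?_ (((hslice' _).comp hσ.measurable).comp measurable_snd)
        exact (measurable_one.indicator hQ).comp (f := fun z : ℝ × E × F => z.2 - (0, z.1 • h))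
          (by fun_prop)
    simp only [W]
    rw [lintegral_const_mul' _ _ ENNReal.ofReal_ne_top]
    simp_rw [h1]
    refine (mul_le_mul_right h2 _).trans (le_of_eq ?_)
    rw [mul_left_comm, ← mul_assoc (ENNReal.ofReal _), ← ENNReal.ofReal_mul (Real.exp_pos _).le,
      ← Real.exp_add]
    have : -(p * (κ * t)) + p * (t * κ) = 0 := by ring
    simp [this]
  -- Sub-mean value property on the disc of radius `1/2` about `i`.
  let g : ℂ → E × F → ℂ := fun w v => lineRestriction Φ f h w (σ v)
  have hg : Continuous (Function.uncurry g) :=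
    (continuous_lineRestriction (Φ := Φ) hf.1.continuous h).comp
      (f := fun z : ℂ × (E × F) => (z.1, σ z.2)) (by fun_prop)
  have hgd : ∀ q, Differentiable ℂ fun w => g w q := fun q =>
    differentiable_lineRestriction (Φ := Φ) hf.1 h (σ q)
  have hsub := windowMean_weighted_subMean (ν := μ) (Q := Q) hp hg hgd isOpen_univ
    (φ := fun w => κ * Complex.I * w) (by fun_prop) (c := Complex.I) (r := 1 / 2)
    (Set.subset_univ _)
  have hW : ∀ w : ℂ, ‖Complex.exp (κ * Complex.I * w)‖ₑ ^ p * windowMean μ Q p g w =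
      W w.re w.im := by
    intro w
    rw [enorm_cexp_mul_I_mul_rpow hp, windowMean]
    simp only [g, lineRestriction_eq_slice, W]
  simp only [hW] at hsub
  have hWmeas : Measurable (Function.uncurry W) := by
    refine Measurable.mul (by fun_prop) ?_
    refine Measurable.lintegral_prod_right' (ν := μ.restrict Q)
      (f := fun z : (ℝ × ℝ) × (E × F) =>
        ‖slice Φ f (z.1.2 • h) (σ z.2 + (0, z.1.1 • h))‖ₑ ^ p) ?_
    refine Measurable.pow_const (Measurable.enorm (Continuous.measurable ?_)) p
    exact hslice.comp (f := fun z : (ℝ × ℝ) × (E × F) => (σ z.2 + (0, z.1.1 • h), z.1.2 • h))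
      (by fun_prop)
  have hRHS : ∫⁻ b in Metric.closedBall (0 : ℂ) (1 / 2), W (Complex.I + b).re (Complex.I + b).im ≤
      D * A := by
    set S : Set ℂ := Complex.measurableEquivRealProd ⁻¹' (Set.univ ×ˢ Set.Icc (-(1 / 2)) (1 / 2))
    have hS : Metric.closedBall (0 : ℂ) (1 / 2) ⊆ S := by
      intro b hb
      have h1 : ‖b‖ ≤ 1 / 2 := by simpa using hb
      have h2 := abs_le.1 ((Complex.abs_im_le_norm b).trans h1)
      exact ⟨Set.mem_univ _, h2⟩
    calc _ ≤ ∫⁻ b in S, W b.re (1 + b.im) := by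
          refine (lintegral_mono_set hS).trans (le_of_eq ?_)
          simp
      _ = ∫⁻ z in Set.univ ×ˢ Set.Icc (-(1 / 2) : ℝ) (1 / 2), W z.1 (1 + z.2) :=
          Complex.volume_preserving_equiv_real_prod.setLIntegral_comp_preimage_emb
            Complex.measurableEquivRealProd.measurableEmbedding
            (fun z : ℝ × ℝ => W z.1 (1 + z.2)) _
      _ = ∫⁻ t in Set.Icc (-(1 / 2) : ℝ) (1 / 2), ∫⁻ s, W s (1 + t) := by
          rw [Measure.volume_eq_prod, ← Measure.prod_restrict, Measure.restrict_univ,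
            lintegral_prod_symm']
          exact hWmeas.comp (g := Function.uncurry W) (f := fun z : ℝ × ℝ => (z.1, 1 + z.2))
            (by fun_prop)
      _ ≤ ∫⁻ t in Set.Icc (-(1 / 2) : ℝ) (1 / 2), D * A :=
          setLIntegral_mono' measurableSet_Icc fun t ht => hline _ (by linarith [ht.1])
      _ = D * A := by
          rw [setLIntegral_const, Real.volume_Icc]
          norm_num
  have hfin := hsub.trans hRHS
  have hWI : W Complex.I.re Complex.I.im = ENNReal.ofReal (Real.exp (-(p * κ))) *
      ∫⁻ v in Q, ‖slice Φ f h (σ v)‖ₑ ^ p ∂μ := by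
    simp only [W, Complex.I_re, Complex.I_im, zero_smul, one_smul, mul_one]
    congr 2
    funext v
    congr 3
    exact add_zero _
  rw [hWI] at hfin
  have h5 := mul_le_mul_right hfin (β⁻¹ * ENNReal.ofReal (Real.exp (p * κ)))
  have e1 : β⁻¹ * ENNReal.ofReal (Real.exp (p * κ)) * (ENNReal.ofReal (Real.exp (-(p * κ))) *
      (∫⁻ v in Q, ‖slice Φ f h (σ v)‖ₑ ^ p ∂μ) * β) =
      (β⁻¹ * β) * (ENNReal.ofReal (Real.exp (p * κ)) * ENNReal.ofReal (Real.exp (-(p * κ)))) *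
        ∫⁻ v in Q, ‖slice Φ f h (σ v)‖ₑ ^ p ∂μ := by ring
  rw [e1, ENNReal.inv_mul_cancel hβ0 hβt, ← ENNReal.ofReal_mul (Real.exp_pos _).le,
    ← Real.exp_add, add_neg_cancel, Real.exp_zero, ENNReal.ofReal_one, one_mul, one_mul] at h5
  refine h5.trans (le_of_eq ?_)
  rw [ENNReal.ofReal_mul (inv_nonneg.2 ENNReal.toReal_nonneg), ENNReal.ofReal_inv_of_pos
    (ENNReal.toReal_pos hβ0 hβt), ENNReal.ofReal_toReal hβt]
  ring

end PlancherelPolya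

/-! ### Translations of `𝒩` and the local pointwise bound -/

section Translation

variable {E F : Type*} [NormedAddCommGroup E] [InnerProductSpace ℂ E]
  [NormedAddCommGroup F] [InnerProductSpace ℝ F]
  {Φ : E →ₗ[ℂ] E →ₗ⋆[ℂ] Complexification F}

/-- Left translation by `v₀` in `𝒩 = E × F` with its (at most) 2-step nilpotent group law
`(ζ₀, x₀) · (ζ, x) = (ζ₀ + ζ, x₀ + x + 2 Im Φ(ζ₀, ζ))`, written here with
`Im Φ(ζ₀, ζ) = -Im Φ(ζ, ζ₀)`. It is induced by an affine automorphism of `E × F_ℂ` which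
preserves `ρ`. -/
noncomputable def heisenbergTranslate (Φ : E →ₗ[ℂ] E →ₗ⋆[ℂ] Complexification F)
    (v₀ v : E × F) : E × F :=
  (v₀.1 + v.1, v₀.2 + v.2 - (2 : ℝ) • (Φ v.1 v₀.1).im)

theorem heisenbergTranslate_add_snd (v₀ v : E × F) (x : F) :
    heisenbergTranslate Φ v₀ (v + (0, x)) = heisenbergTranslate Φ v₀ v + (0, x) := by
  ext
  · simp [heisenbergTranslate]
  · simp only [heisenbergTranslate, Prod.fst_add, Prod.snd_add, add_zero]
    abel

theorem quadPart_add (hΦ : IsHermitianMap Φ) (ζ ζ' : E) :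
    quadPart Φ (ζ' + ζ) = quadPart Φ ζ' + quadPart Φ ζ + (2 : ℝ) • (Φ ζ ζ').re := by
  have h := congrArg re (hΦ ζ ζ')
  simp only [conj, re_mk] at h
  simp only [quadPart, map_add, LinearMap.add_apply, re_add, h]
  module

variable [FiniteDimensional ℂ E]

theorem continuous_heisenbergTranslate (v₀ : E × F) :
    Continuous (heisenbergTranslate Φ v₀) := by
  have h : Continuous fun v : E × F => (Φ v.1 v₀.1).im :=
    continuous_im.comp ((continuous_sesq Φ).comp (continuous_fst.prodMk continuous_const))
  unfold heisenbergTranslate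
  fun_prop

variable [MeasurableSpace E] [BorelSpace E] [FiniteDimensional ℝ F]
  [MeasurableSpace F] [BorelSpace F]

theorem measurePreserving_heisenbergTranslate (μ : Measure (E × F)) [μ.IsAddHaarMeasure]
    (v₀ : E × F) : MeasurePreserving (heisenbergTranslate Φ v₀) μ μ := by
  have : ProperSpace E := FiniteDimensional.proper ℂ E
  have h : MeasurePreserving (heisenbergTranslate Φ v₀)
      ((Measure.addHaar : Measure E).prod (volume : Measure F))
      ((Measure.addHaar : Measure E).prod (volume : Measure F)) := by
    have hm := (continuous_heisenbergTranslate (Φ := Φ) v₀).measurable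
    refine MeasurePreserving.skew_product (f := fun ζ => v₀.1 + ζ)
      (g := fun ζ x => v₀.2 + x - (2 : ℝ) • (Φ ζ v₀.1).im)
      (measurePreserving_add_left _ _) hm.snd ?_
    refine Eventually.of_forall fun ζ => ?_
    have e : (fun x => v₀.2 + x - (2 : ℝ) • (Φ ζ v₀.1).im) =
        fun x => (v₀.2 - (2 : ℝ) • (Φ ζ v₀.1).im) + x := by
      funext x; abel
    rw [e]
    exact (measurePreserving_add_left _ _).map_eq
  rw [Measure.isAddLeftInvariant_eq_smul μ
    ((Measure.addHaar : Measure E).prod (volume : Measure F))]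
  exact h.smul_measure _

/-- Pointwise values of a slice are bounded by means over nearby slices, with constants that do not
depend on the point: move the point to the origin by an affine automorphism of `E × F_ℂ` and use
the sub-mean value property on a ball, written in the coordinates `(ζ, x, h)` with
`z = x + i (Φ(ζ) + h)`. -/
theorem exists_enorm_slice_rpow_le (hΦ : IsHermitianMap Φ) (μ : Measure (E × F))
    [μ.IsAddHaarMeasure] {p : ℝ} (hp : 0 < p) :
    ∃ (c : ℝ≥0∞) (R : ℝ), c ≠ ∞ ∧ 0 < R ∧ ∀ f : E × Complexification F → ℂ, Differentiable ℂ f →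
      ∀ (h₀ : F) (v₀ : E × F), ‖slice Φ f h₀ v₀‖ₑ ^ p ≤
        c * ∫⁻ h in Metric.closedBall 0 R, ∫⁻ v in Metric.closedBall 0 1,
          ‖slice Φ f (h₀ + h) (heisenbergTranslate Φ v₀ v)‖ₑ ^ p ∂μ := by
  have : ProperSpace E := FiniteDimensional.proper ℂ E
  have : FiniteDimensional ℂ (Complexification F) := Complexification.finiteDimensional
  let _ : MeasurableSpace (E × Complexification F) := borel _
  have : BorelSpace (E × Complexification F) := ⟨rfl⟩
  obtain ⟨c₀, hc₀, hΦc⟩ := exists_norm_sesq_le Φ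
  let T : ((E × F) × F) ≃L[ℝ] E × Complexification F :=
    (ContinuousLinearEquiv.prodAssoc ℝ E F F).trans
      ((ContinuousLinearEquiv.refl ℝ E).prodCongr mkContinuousLinearEquiv)
  have hT : ∀ u, T u = (u.1.1, mk u.1.2 u.2) := fun u => rfl
  let m : Measure (E × Complexification F) := (μ.prod (volume : Measure F)).map T
  have hm : m.IsAddHaarMeasure := T.isAddHaarMeasure_map (μ.prod volume)
  set B : Set (E × Complexification F) := Metric.closedBall 0 1 with hB
  have hB0 : m B ≠ 0 := (Metric.measure_closedBall_pos m 0 one_pos).ne'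
  have : ProperSpace (E × Complexification F) := FiniteDimensional.proper ℂ _
  have hBt : m B ≠ ∞ := (isCompact_closedBall (0 : E × Complexification F) 1).measure_lt_top.ne
  refine ⟨(m B)⁻¹, 1 + c₀, ENNReal.inv_ne_top.2 hB0, by positivity, fun f hf h₀ v₀ => ?_⟩
  -- `f` after the affine automorphism of `E × F_ℂ` which sends `0` to the point of height `h₀`
  -- over `v₀`.
  let f' : E × Complexification F → ℂ := fun w =>
    f (v₀.1 + w.1, mk v₀.2 (quadPart Φ v₀.1 + h₀) + w.2 + (2 * Complex.I) • Φ.flip v₀.1 w.1)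
  have hf' : Differentiable ℂ f' := by
    have h1 : Differentiable ℂ fun ζ : E => Φ.flip v₀.1 ζ :=
      (LinearMap.toContinuousLinearMap (Φ.flip v₀.1)).differentiable
    have h2 : Differentiable ℂ fun w : E × Complexification F => Φ.flip v₀.1 w.1 :=
      h1.comp differentiable_fst
    exact hf.comp (by fun_prop)
  have hf'T : ∀ u, f' (T u) =
      slice Φ f (h₀ + (u.2 - quadPart Φ u.1.1)) (heisenbergTranslate Φ v₀ u.1) := by
    intro u
    simp only [hT, f', slice, heisenbergTranslate, LinearMap.flip_apply]
    congr 2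
    ext
    · simp
      abel
    · simp [quadPart_add hΦ]
      abel
  have hf'0 : f' 0 = slice Φ f h₀ v₀ := by
    simp [f', slice]
  have hmean := enorm_rpow_mul_measure_le m hp isOpen_univ hf'.differentiableOn (c := 0) (r := 1)
    (Set.subset_univ _)
  simp only [zero_add, hf'0] at hmean
  have hTe : MeasurableEmbedding T := T.toHomeomorph.measurableEmbedding
  have hslice := continuous_slice (Φ := Φ) hf.continuous
  have hσ := continuous_heisenbergTranslate (Φ := Φ) v₀
  have hint : ∫⁻ b in B, ‖f' b‖ₑ ^ p ∂m ≤ ∫⁻ h in Metric.closedBall 0 (1 + c₀),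
      ∫⁻ v in Metric.closedBall 0 1,
        ‖slice Φ f (h₀ + h) (heisenbergTranslate Φ v₀ v)‖ₑ ^ p ∂μ := by
    calc ∫⁻ b in B, ‖f' b‖ₑ ^ p ∂m
        = ∫⁻ u in T ⁻¹' B, ‖f' (T u)‖ₑ ^ p ∂(μ.prod volume) := by
          rw [hTe.restrict_map, hTe.lintegral_map]
      _ ≤ ∫⁻ u in Metric.closedBall (0 : E × F) 1 ×ˢ Metric.closedBall (0 : F) 1,
            ‖f' (T u)‖ₑ ^ p ∂(μ.prod volume) := by
          refine lintegral_mono_set fun u hu => ?_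
          have hu' : ‖T u‖ ≤ 1 := by simpa [hB] using hu
          rw [hT] at hu'
          have h1 := (norm_fst_le _).trans hu'
          have h2 := (norm_snd_le _).trans hu'
          have h3 := (norm_re_le _).trans h2
          have h4 := (norm_im_le _).trans h2
          simp only [re_mk, im_mk] at h1 h3 h4
          simp only [Set.mem_prod, mem_closedBall_zero_iff]
          exact ⟨max_le h1 h3, h4⟩
      _ = ∫⁻ v in Metric.closedBall (0 : E × F) 1, ∫⁻ y in Metric.closedBall (0 : F) 1,
            ‖slice Φ f (h₀ + (y - quadPart Φ v.1)) (heisenbergTranslate Φ v₀ v)‖ₑ ^ p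
              ∂volume ∂μ := by
          rw [← Measure.prod_restrict, lintegral_prod]
          · simp_rw [hf'T]
          · have : Continuous f' := hf'.continuous
            exact ((this.comp T.continuous).measurable.enorm.pow_const p).aemeasurable
      _ ≤ ∫⁻ v in Metric.closedBall (0 : E × F) 1, ∫⁻ h in Metric.closedBall (0 : F) (1 + c₀),
            ‖slice Φ f (h₀ + h) (heisenbergTranslate Φ v₀ v)‖ₑ ^ p ∂volume ∂μ := by
          refine setLIntegral_mono' Metric.isClosed_closedBall.measurableSet fun v hv => ?_
          rw [← lintegral_indicator Metric.isClosed_closedBall.measurableSet,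
            ← lintegral_add_right_eq_self _ (quadPart Φ v.1),
            ← lintegral_indicator Metric.isClosed_closedBall.measurableSet]
          refine lintegral_mono fun y => ?_
          by_cases hy : y + quadPart Φ v.1 ∈ Metric.closedBall (0 : F) 1
          · have hy' : y ∈ Metric.closedBall (0 : F) (1 + c₀) := by
              rw [mem_closedBall_zero_iff] at hy hv ⊢
              have h1 : ‖v.1‖ ≤ 1 := (norm_fst_le v).trans hv
              have h2 : ‖quadPart Φ v.1‖ ≤ c₀ := by
                refine (norm_re_le _).trans ((hΦc _ _).trans ?_)
                rw [mul_assoc]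
                exact mul_le_of_le_one_right hc₀ (mul_le_one₀ h1 (norm_nonneg _) h1)
              have h3 := norm_sub_le (y + quadPart Φ v.1) (quadPart Φ v.1)
              rw [add_sub_cancel_right] at h3
              linarith
            rw [Set.indicator_of_mem hy, Set.indicator_of_mem hy', add_sub_cancel_right]
          · rw [Set.indicator_of_notMem hy]
            exact zero_le
      _ = _ := by
          rw [lintegral_lintegral_swap]
          refine Measurable.aemeasurable (Measurable.pow_const (Measurable.enorm ?_) p)
          refine Continuous.measurable ?_
          exact hslice.comp (f := fun z : (E × F) × F => (heisenbergTranslate Φ v₀ z.1, h₀ + z.2))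
            (by fun_prop)
  have hfin := mul_le_mul_right (hmean.trans hint) (m B)⁻¹
  rwa [mul_comm (‖slice Φ f h₀ v₀‖ₑ ^ p), ← mul_assoc, ENNReal.inv_mul_cancel hB0 hBt,
    one_mul] at hfin

end Translation

/-! ### Uniform bounds and decay at infinity -/

/-- Interpolation between an `L^p` bound and a uniform bound. -/
theorem eLpNorm_le_rpow_mul_rpow {X : Type*} [MeasurableSpace X] {μ : Measure X} {g : X → ℂ}
    {p q : ℝ≥0∞} (hp0 : 0 < p) (hp : p < ∞) (hpq : p ≤ q) {b A : ℝ≥0∞} (hb : b ≠ ∞) (hA : A ≠ ∞)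
    (hsup : ∀ x, ‖g x‖ₑ ^ p.toReal ≤ b * A) (hint : ∫⁻ x, ‖g x‖ₑ ^ p.toReal ∂μ ≤ A) :
    eLpNorm g q μ ≤ b ^ ((p⁻¹).toReal - (q⁻¹).toReal) * A ^ (p⁻¹).toReal := by
  have hP : 0 < p.toReal := ENNReal.toReal_pos hp0.ne' hp.ne
  rw [ENNReal.toReal_inv, ENNReal.toReal_inv]
  rcases eq_or_ne q ∞ with rfl | hq
  · rw [eLpNorm_exponent_top, ENNReal.toReal_top, inv_zero, sub_zero,
      ← ENNReal.mul_rpow_of_nonneg _ _ (inv_nonneg.2 hP.le)]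
    refine essSup_le_of_ae_le _ (Eventually.of_forall fun x => ?_)
    exact (ENNReal.le_rpow_inv_iff hP).2 (hsup x)
  have hq0 : q ≠ 0 := (hp0.trans_le hpq).ne'
  have hQ : 0 < q.toReal := ENNReal.toReal_pos hq0 hq
  have hPQ : p.toReal ≤ q.toReal := ENNReal.toReal_mono hq hpq
  set P := p.toReal
  set Q := q.toReal
  have hθ : 0 ≤ (Q - P) / P := div_nonneg (by linarith) hP.le
  rw [eLpNorm_eq_lintegral_rpow_enorm_toReal hq0 hq, one_div]
  have h1 : ∫⁻ x, ‖g x‖ₑ ^ Q ∂μ ≤ (b * A) ^ ((Q - P) / P) * A := by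
    calc ∫⁻ x, ‖g x‖ₑ ^ Q ∂μ ≤ ∫⁻ x, (b * A) ^ ((Q - P) / P) * ‖g x‖ₑ ^ P ∂μ := by
          refine lintegral_mono fun x => ?_
          have e : Q = P * ((Q - P) / P) + P := by field_simp; ring
          calc ‖g x‖ₑ ^ Q = (‖g x‖ₑ ^ P) ^ ((Q - P) / P) * ‖g x‖ₑ ^ P := by
                conv_lhs => rw [e]
                rw [ENNReal.rpow_add_of_nonneg _ _ (mul_nonneg hP.le hθ) hP.le, ENNReal.rpow_mul]
            _ ≤ _ := by
                gcongr
                exact hsup x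
      _ = (b * A) ^ ((Q - P) / P) * ∫⁻ x, ‖g x‖ₑ ^ P ∂μ :=
          lintegral_const_mul' _ _ (ENNReal.rpow_ne_top_of_nonneg hθ (ENNReal.mul_ne_top hb hA))
      _ ≤ _ := by gcongr
  refine (ENNReal.rpow_le_rpow h1 (inv_nonneg.2 hQ.le)).trans (le_of_eq ?_)
  have hθ' : 0 ≤ P⁻¹ - Q⁻¹ := sub_nonneg.2 (inv_anti₀ hP hPQ)
  rw [ENNReal.mul_rpow_of_nonneg _ _ (inv_nonneg.2 hQ.le), ← ENNReal.rpow_mul,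
    show (Q - P) / P * Q⁻¹ = P⁻¹ - Q⁻¹ by field_simp, ENNReal.mul_rpow_of_nonneg _ _ hθ', mul_assoc,
    ← ENNReal.rpow_add_of_nonneg _ _ hθ' (inv_nonneg.2 hQ.le), sub_add_cancel]

theorem volume_line_inter_closedBall_le {E F : Type*} [NormedAddCommGroup E]
    [NormedAddCommGroup F] [NormedSpace ℝ F] {h : F} (hh : h ≠ 0) (v : E × F) :
    volume {s : ℝ | v - (0, s • h) ∈ Metric.closedBall (0 : E × F) 1} ≤
      ENNReal.ofReal (2 / ‖h‖) := by
  have hh' : 0 < ‖h‖ := norm_pos_iff.2 hh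
  refine (Real.volume_le_diam _).trans (Metric.ediam_le fun s hs t ht => ?_)
  rw [edist_dist]
  refine ENNReal.ofReal_le_ofReal ?_
  have h1 : ‖v.2 - s • h‖ ≤ 1 := (norm_snd_le _).trans (mem_closedBall_zero_iff.1 hs)
  have h2 : ‖v.2 - t • h‖ ≤ 1 := (norm_snd_le _).trans (mem_closedBall_zero_iff.1 ht)
  have h3 := norm_sub_le (v.2 - t • h) (v.2 - s • h)
  rw [sub_sub_sub_cancel_left, ← sub_smul, norm_smul] at h3
  rw [dist_eq_norm, le_div_iff₀ hh']
  linarith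

section Estimates

variable {E F : Type*} [NormedAddCommGroup E] [InnerProductSpace ℂ E] [FiniteDimensional ℂ E]
  [MeasurableSpace E] [BorelSpace E]
  [NormedAddCommGroup F] [InnerProductSpace ℝ F] [FiniteDimensional ℝ F]
  [MeasurableSpace F] [BorelSpace F] {μ : Measure (E × F)} [μ.IsAddHaarMeasure]
  {Φ : E →ₗ[ℂ] E →ₗ⋆[ℂ] Complexification F} {K : Set (StrongDual ℝ F)} {p : ℝ}

variable (μ) in
/-- Uniform bounds for `|f_h| ^ p`: the Plancherel–Pólya bound, and the gain of a factor
`1 / ‖h‖`. -/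
theorem exists_enorm_slice_rpow_le_lintegral (hΦ : IsHermitianMap Φ) (hp : 0 < p)
    (hK : IsCompact K) (hne : K.Nonempty) :
    ∃ C : ℝ, 0 < C ∧ ∀ f ∈ expTypeSpace Φ K, ∀ (h : F) (v : E × F),
      ‖slice Φ f h v‖ₑ ^ p ≤ ENNReal.ofReal (C * Real.exp (p * realSupp K h)) *
        ∫⁻ v, ‖slice Φ f 0 v‖ₑ ^ p ∂μ ∧
      (h ≠ 0 → ‖slice Φ f h v‖ₑ ^ p ≤ ENNReal.ofReal (C / ‖h‖ * Real.exp (p * realSupp K h)) *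
        ∫⁻ v, ‖slice Φ f 0 v‖ₑ ^ p ∂μ) := by
  obtain ⟨c, R, hc, hR, hloc⟩ := exists_enorm_slice_rpow_le hΦ μ hp
  obtain ⟨c₁, hc₁, hwin⟩ := setLIntegral_slice_comp_le (Φ := Φ) (μ := μ) hp hK hne
  obtain ⟨L, hL0, hL⟩ := hK.isBounded.exists_pos_norm_le
  set B : Set F := Metric.closedBall 0 R with hB
  have hBt : volume B ≠ ∞ := (isCompact_closedBall (0 : F) R).measure_lt_top.ne
  set γ : ℝ := (c * volume B).toReal
  have hγ0 : 0 ≤ γ := ENNReal.toReal_nonneg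
  have hγ : c * volume B = ENNReal.ofReal γ :=
    (ENNReal.ofReal_toReal (ENNReal.mul_ne_top hc hBt)).symm
  set e₁ : ℝ := Real.exp (p * (L * R)) with he₁
  have hsupp : ∀ h, ∀ h' ∈ B, Real.exp (p * realSupp K (h + h')) ≤
      e₁ * Real.exp (p * realSupp K h) := by
    intro h h' hh'
    rw [he₁, ← Real.exp_add, ← mul_add, add_comm (L * R)]
    have h1 := realSupp_add_le hK hne hL h h'
    have h2 : L * ‖h'‖ ≤ L * R := by gcongr; simpa [hB] using hh'
    exact Real.exp_le_exp.2 (mul_le_mul_of_nonneg_left (by linarith) hp.le)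
  refine ⟨γ * e₁ * (1 + 4 * c₁ + 2 * R) + 1, by positivity, fun f hf h v => ?_⟩
  set A := ∫⁻ v, ‖slice Φ f 0 v‖ₑ ^ p ∂μ
  have hslice : ∀ h, Measurable fun v => ‖slice Φ f h v‖ₑ ^ p := fun h => by
    have : Continuous (slice Φ f h) :=
      (continuous_slice (Φ := Φ) hf.1.continuous).comp (Continuous.prodMk_left h)
    exact this.measurable.enorm.pow_const p
  have hσ := measurePreserving_heisenbergTranslate (Φ := Φ) μ v
  -- It suffices to bound the window integrals at height `h + h'` for `‖h'‖ ≤ R`.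
  have hred : ∀ M : ℝ, 0 ≤ M → (∀ h' ∈ B, ∫⁻ v' in Metric.closedBall 0 1,
      ‖slice Φ f (h + h') (heisenbergTranslate Φ v v')‖ₑ ^ p ∂μ ≤
        ENNReal.ofReal (M * Real.exp (p * realSupp K (h + h'))) * A) →
      ∀ N : ℝ, γ * e₁ * M ≤ N →
      ‖slice Φ f h v‖ₑ ^ p ≤ ENNReal.ofReal (N * Real.exp (p * realSupp K h)) * A := by
    intro M hM hw N hN
    refine (hloc f hf.1 h v).trans ?_
    calc _ ≤ c * ∫⁻ h' in B, ENNReal.ofReal (M * (e₁ * Real.exp (p * realSupp K h))) * A := by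
          refine mul_le_mul_right (setLIntegral_mono' Metric.isClosed_closedBall.measurableSet
            fun h' hh' => (hw h' hh').trans ?_) _
          gcongr
          exact hsupp h h' hh'
      _ = ENNReal.ofReal (γ * (M * (e₁ * Real.exp (p * realSupp K h)))) * A := by
          rw [setLIntegral_const, ENNReal.ofReal_mul hγ0, ← hγ]
          ring
      _ ≤ _ := by
          refine mul_le_mul_left (ENNReal.ofReal_le_ofReal ?_) _
          calc _ = γ * e₁ * M * Real.exp (p * realSupp K h) := by ring
            _ ≤ _ := by gcongr
  have hunif : ∀ h' ∈ B, ∫⁻ v' in Metric.closedBall 0 1,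
      ‖slice Φ f (h + h') (heisenbergTranslate Φ v v')‖ₑ ^ p ∂μ ≤
        ENNReal.ofReal (1 * Real.exp (p * realSupp K (h + h'))) * A := by
    intro h' _
    refine (setLIntegral_le_lintegral _ _).trans ?_
    rw [hσ.lintegral_comp (hslice _), one_mul]
    exact lintegral_slice_le hp hK hne hf _
  have hge : 0 ≤ γ * e₁ := by positivity
  refine ⟨hred 1 zero_le_one hunif _ (by nlinarith), fun hh => ?_⟩
  have hh' : 0 < ‖h‖ := norm_pos_iff.2 hh
  rcases le_total (2 * R) ‖h‖ with hlarge | hsmall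
  -- For `‖h‖ ≥ 2 * R` all heights involved have norm at least `‖h‖ / 2`; for `‖h‖ ≤ 2 * R` the
  -- bound without gain suffices.
  · refine hred (4 * c₁ / ‖h‖) (by positivity) (fun h' hB' => ?_) _ ?_
    · have hn : ‖h'‖ ≤ R := by simpa [hB] using hB'
      have hn2 : ‖h‖ / 2 ≤ ‖h + h'‖ := by
        have := norm_sub_le (h + h') h'
        rw [add_sub_cancel_right] at this
        linarith
      have hne' : h + h' ≠ 0 := norm_pos_iff.1 (lt_of_lt_of_le (by positivity) hn2)
      refine (hwin f hf (h + h') (heisenbergTranslate Φ v) (continuous_heisenbergTranslate v) hσ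
        (heisenbergTranslate_add_snd v) _ Metric.isClosed_closedBall.measurableSet _
        (volume_line_inter_closedBall_le hne')).trans ?_
      rw [← ENNReal.ofReal_mul (by positivity)]
      refine mul_le_mul_left (ENNReal.ofReal_le_ofReal ?_) _
      calc c₁ * Real.exp (p * realSupp K (h + h')) * (2 / ‖h + h'‖)
          ≤ c₁ * Real.exp (p * realSupp K (h + h')) * (2 / (‖h‖ / 2)) := by gcongr
        _ = 4 * c₁ / ‖h‖ * Real.exp (p * realSupp K (h + h')) := by field_simp; ring
    · rw [mul_div_assoc']
      gcongr
      nlinarith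
  · refine hred 1 zero_le_one hunif _ ?_
    rw [le_div_iff₀ hh']
    nlinarith

/-- Decay at infinity. Where `ρ` is large, use the gain of a factor `1 / ‖ρ‖`; where `ρ` is bounded,
the local means of `|f| ^ p` are tails of a convergent integral over `𝒩` times a ball of `F`. -/
theorem tendsto_exp_neg_suppFun_mul (hΦ : IsHermitianMap Φ) (hp : 0 < p)
    (hK : IsCompact K) (hne : K.Nonempty) {f : E × Complexification F → ℂ}
    (hf : f ∈ expTypeSpace Φ K) (hA : ∫⁻ v, ‖slice Φ f 0 v‖ₑ ^ p ∂μ ≠ ∞) :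
    Tendsto (fun w : E × Complexification F => EReal.exp (-suppFun K (rho Φ w)) * ‖f w‖ₑ)
        (cocompact (E × Complexification F)) (𝓝 0) := by
  have : ProperSpace E := FiniteDimensional.proper ℂ E
  have : FiniteDimensional ℂ (Complexification F) := Complexification.finiteDimensional
  have : ProperSpace (E × Complexification F) := FiniteDimensional.proper ℂ _
  set A := ∫⁻ v, ‖slice Φ f 0 v‖ₑ ^ p ∂μ with hAdef
  obtain ⟨C, hC, hdecay⟩ := exists_enorm_slice_rpow_le_lintegral μ hΦ hp hK hne
  obtain ⟨c, R, hc, hR, hloc⟩ := exists_enorm_slice_rpow_le hΦ μ hp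
  obtain ⟨L, hL0, hL⟩ := hK.isBounded.exists_pos_norm_le
  obtain ⟨c₀, hc₀, hΦc⟩ := exists_norm_sesq_le Φ
  have hslicec := continuous_slice (Φ := Φ) hf.1.continuous
  have hzero : realSupp K 0 = 0 := by
    simpa using realSupp_smul hK hne le_rfl (0 : F)
  have hsl : ∀ w : E × Complexification F, f w = slice Φ f (rho Φ w) (w.1, w.2.re) := by
    intro w
    simp only [slice, rho, add_sub_cancel]
    rfl
  rw [ENNReal.tendsto_nhds_zero]
  intro ε hε
  wlog hεt : ε ≠ ∞ generalizing ε
  · refine (this 1 one_pos ENNReal.one_ne_top).mono fun w hw => hw.trans ?_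
    rw [not_not.1 hεt]
    exact le_top
  have hεp : 0 < ε ^ p := ENNReal.rpow_pos hε hεt
  -- Reduction to an estimate of `e^{-p H(ρ)} |f| ^ p`.
  have hred : ∀ w : E × Complexification F,
      ENNReal.ofReal (Real.exp (-(p * realSupp K (rho Φ w)))) *
        ‖slice Φ f (rho Φ w) (w.1, w.2.re)‖ₑ ^ p ≤ ε ^ p →
      EReal.exp (-suppFun K (rho Φ w)) * ‖f w‖ₑ ≤ ε := by
    intro w hw
    rw [← ENNReal.rpow_le_rpow_iff hp, ENNReal.mul_rpow_of_nonneg _ _ hp.le,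
      coe_realSupp hK hne, ← EReal.coe_neg, EReal.exp_coe,
      ENNReal.ofReal_rpow_of_nonneg (Real.exp_pos _).le hp.le, ← Real.exp_mul, neg_mul,
      mul_comm _ p]
    rwa [← hsl w] at hw
  -- Large `ρ`: the decay in the direction of `ρ`.
  obtain ⟨R₁, hR₁0, hR₁⟩ : ∃ R₁ : ℝ, 0 < R₁ ∧ ∀ h : F, R₁ ≤ ‖h‖ →
      ENNReal.ofReal (C / ‖h‖) * A ≤ ε ^ p := by
    have h1 : Tendsto (fun r : ℝ => ENNReal.ofReal (C / r) * A) atTop (𝓝 0) := by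
      have h2 : Tendsto (fun r : ℝ => ENNReal.ofReal (C / r)) atTop (𝓝 0) := by
        simpa using ENNReal.tendsto_ofReal (tendsto_const_nhds.div_atTop tendsto_id (a := C))
      simpa using ENNReal.Tendsto.mul_const h2 (Or.inr hA)
    obtain ⟨r, hr⟩ := eventually_atTop.1 (ENNReal.tendsto_nhds_zero.1 h1 _ hεp)
    exact ⟨max r 1, by positivity, fun h hh => hr _ ((le_max_left _ _).trans hh)⟩
  -- Bounded `ρ`: integrate over the bounded heights.
  set S : Set F := Metric.closedBall 0 (R₁ + R) with hS
  have hSm : MeasurableSet S := Metric.isClosed_closedBall.measurableSet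
  have hSt : volume S ≠ ∞ := (isCompact_closedBall (0 : F) (R₁ + R)).measure_lt_top.ne
  let Ψ : E × F → ℝ≥0∞ := fun v => ∫⁻ h in S, ‖slice Φ f h v‖ₑ ^ p
  have hmeas2 : Measurable fun z : (E × F) × F => ‖slice Φ f z.2 z.1‖ₑ ^ p :=
    hslicec.measurable.enorm.pow_const p
  have hΨm : Measurable Ψ := Measurable.lintegral_prod_right' hmeas2
  have hsuppb : ∀ h : F, realSupp K h ≤ L * ‖h‖ ∧ -realSupp K h ≤ L * ‖h‖ := by
    intro h
    have h1 := realSupp_add_le hK hne hL 0 h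
    have h2 := realSupp_add_le hK hne hL h (-h)
    rw [zero_add, hzero] at h1
    rw [add_neg_cancel, hzero, norm_neg] at h2
    exact ⟨by linarith, by linarith⟩
  have hΨfin : ∫⁻ v, Ψ v ∂μ ≠ ∞ := by
    have h1 : ∫⁻ v, Ψ v ∂μ ≤
        ∫⁻ h in S, ENNReal.ofReal (Real.exp (p * (L * (R₁ + R)))) * A := by
      simp only [Ψ]
      rw [lintegral_lintegral_swap hmeas2.aemeasurable]
      refine setLIntegral_mono' hSm fun h hh => ?_
      refine (lintegral_slice_le hp hK hne hf h).trans ?_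
      have h2 : ‖h‖ ≤ R₁ + R := by simpa [hS] using hh
      have h3 : L * ‖h‖ ≤ L * (R₁ + R) := by gcongr
      have h4 := (hsuppb h).1.trans h3
      gcongr
    refine ne_top_of_le_ne_top ?_ h1
    rw [setLIntegral_const]
    exact ENNReal.mul_ne_top (ENNReal.mul_ne_top ENNReal.ofReal_ne_top hA) hSt
  have htail : Tendsto (fun n : ℕ => ENNReal.ofReal (Real.exp (p * (L * R₁))) * c *
      ∫⁻ v, (Metric.closedBall (0 : E × F) n)ᶜ.indicator Ψ v ∂μ) atTop (𝓝 0) := by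
    have h1 : Tendsto (fun n : ℕ => ∫⁻ v, (Metric.closedBall (0 : E × F) n)ᶜ.indicator Ψ v ∂μ)
        atTop (𝓝 (∫⁻ _, 0 ∂μ)) := by
      refine tendsto_lintegral_of_dominated_convergence Ψ (fun n => ?_) (fun n => ?_) hΨfin ?_
      · exact hΨm.indicator Metric.isClosed_closedBall.measurableSet.compl
      · exact Eventually.of_forall fun v => Set.indicator_le_self _ _ v
      · refine Eventually.of_forall fun v => ?_
        refine tendsto_const_nhds.congr' ?_
        filter_upwards [tendsto_natCast_atTop_atTop.eventually_ge_atTop ‖v‖] with n hn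
        rw [Set.indicator_of_notMem]
        simpa using hn
    rw [lintegral_zero] at h1
    simpa using ENNReal.Tendsto.const_mul h1
      (Or.inr (ENNReal.mul_ne_top ENNReal.ofReal_ne_top hc))
  obtain ⟨n, hn⟩ := (ENNReal.tendsto_nhds_zero.1 htail _ hεp).exists
  set T : ℝ := (n + 1) + ((n + 1) + 2 * (c₀ * (n + 1)) + (R₁ + c₀ * (n + 1) * (n + 1)))
  filter_upwards [(isCompact_closedBall (0 : E × Complexification F) T).compl_mem_cocompact]
    with w hw
  refine hred w ?_
  set h := rho Φ w with hh
  set v : E × F := (w.1, w.2.re) with hv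
  rcases le_or_gt R₁ ‖h‖ with hlarge | hsmall
  · refine le_trans ?_ (hR₁ h hlarge)
    have hh0 : h ≠ 0 := norm_pos_iff.1 (hR₁0.trans_le hlarge)
    refine (mul_le_mul_right ((hdecay f hf h v).2 hh0) _).trans (le_of_eq ?_)
    rw [← mul_assoc, ← ENNReal.ofReal_mul (Real.exp_pos _).le, mul_left_comm, ← Real.exp_add,
      neg_add_cancel, Real.exp_zero, mul_one]
  · have hfar : ∀ v' ∈ Metric.closedBall (0 : E × F) 1,
        heisenbergTranslate Φ v v' ∈ (Metric.closedBall (0 : E × F) n)ᶜ := by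
      intro v' hv' hmem
      refine hw ?_
      rw [mem_closedBall_zero_iff] at hv' hmem ⊢
      have h1 : ‖v'.1‖ ≤ 1 := (norm_fst_le _).trans hv'
      have h2 : ‖v'.2‖ ≤ 1 := (norm_snd_le _).trans hv'
      have h3 : ‖w.1 + v'.1‖ ≤ n := (norm_fst_le _).trans hmem
      have h4 : ‖w.2.re + v'.2 - (2 : ℝ) • (Φ v'.1 w.1).im‖ ≤ n := (norm_snd_le _).trans hmem
      have h5 : ‖w.1‖ ≤ n + 1 := by
        have := norm_sub_le (w.1 + v'.1) v'.1
        rw [add_sub_cancel_right] at this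
        linarith
      have h6 : ‖(Φ v'.1 w.1).im‖ ≤ c₀ * (n + 1) := by
        refine (norm_im_le _).trans ((hΦc _ _).trans ?_)
        have : c₀ * ‖v'.1‖ ≤ c₀ := mul_le_of_le_one_right hc₀ h1
        gcongr
      have h7 : ‖w.2.re‖ ≤ (n + 1) + 2 * (c₀ * (n + 1)) := by
        have e : w.2.re = (w.2.re + v'.2 - (2 : ℝ) • (Φ v'.1 w.1).im) - v'.2 +
            (2 : ℝ) • (Φ v'.1 w.1).im := by abel
        rw [e]
        refine (norm_add_le _ _).trans (add_le_add ((norm_sub_le _ _).trans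
          (add_le_add h4 h2)) ?_)
        rw [norm_smul, Real.norm_two]
        gcongr
      have h8 : ‖w.2.im‖ ≤ R₁ + c₀ * (n + 1) * (n + 1) := by
        have e : w.2.im = h + quadPart Φ w.1 := by simp [hh, rho]
        rw [e]
        refine (norm_add_le _ _).trans (add_le_add hsmall.le ?_)
        refine (norm_re_le _).trans ((hΦc _ _).trans ?_)
        gcongr
      refine max_le ?_ ?_
      · refine h5.trans (le_add_of_nonneg_right (by positivity))
      · exact (norm_le_add _).trans ((add_le_add h7 h8).trans
          (le_add_of_nonneg_left (by positivity)))
    refine le_trans ?_ hn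
    have hσ := continuous_heisenbergTranslate (Φ := Φ) v
    have hσμ := measurePreserving_heisenbergTranslate (Φ := Φ) μ v
    have hinner : ∫⁻ h' in Metric.closedBall 0 R, ∫⁻ v' in Metric.closedBall 0 1,
        ‖slice Φ f (h + h') (heisenbergTranslate Φ v v')‖ₑ ^ p ∂μ ≤
        ∫⁻ v, (Metric.closedBall (0 : E × F) n)ᶜ.indicator Ψ v ∂μ := by
      calc _ = ∫⁻ h', (Metric.closedBall (0 : F) R).indicator (fun h' =>
              ∫⁻ v' in Metric.closedBall 0 1,
                ‖slice Φ f (h + h') (heisenbergTranslate Φ v v')‖ₑ ^ p ∂μ) h' :=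
            (lintegral_indicator Metric.isClosed_closedBall.measurableSet _).symm
        _ ≤ ∫⁻ h', S.indicator (fun h' => ∫⁻ v' in Metric.closedBall 0 1,
                ‖slice Φ f h' (heisenbergTranslate Φ v v')‖ₑ ^ p ∂μ) (h + h') := by
            refine lintegral_mono fun h' => ?_
            by_cases hh' : h' ∈ Metric.closedBall (0 : F) R
            · have : h + h' ∈ S := by
                rw [mem_closedBall_zero_iff] at hh'
                rw [hS, mem_closedBall_zero_iff]
                exact (norm_add_le _ _).trans (add_le_add hsmall.le hh')
              rw [Set.indicator_of_mem hh', Set.indicator_of_mem this]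
            · rw [Set.indicator_of_notMem hh']
              exact zero_le
        _ = ∫⁻ h' in S, ∫⁻ v' in Metric.closedBall 0 1,
                ‖slice Φ f h' (heisenbergTranslate Φ v v')‖ₑ ^ p ∂μ := by
            rw [lintegral_add_left_eq_self, lintegral_indicator hSm]
        _ = ∫⁻ v' in Metric.closedBall 0 1, Ψ (heisenbergTranslate Φ v v') ∂μ := by
            rw [lintegral_lintegral_swap]
            refine Measurable.aemeasurable (hmeas2.comp
              (g := fun z : (E × F) × F => ‖slice Φ f z.2 z.1‖ₑ ^ p)
              (f := fun z : F × (E × F) => (heisenbergTranslate Φ v z.2, z.1)) ?_)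
            exact (hσ.measurable.comp measurable_snd).prodMk measurable_fst
        _ ≤ ∫⁻ v', (Metric.closedBall (0 : E × F) n)ᶜ.indicator Ψ
              (heisenbergTranslate Φ v v') ∂μ := by
            refine (setLIntegral_mono' Metric.isClosed_closedBall.measurableSet
              fun v' hv' => ?_).trans (setLIntegral_le_lintegral _ _)
            rw [Set.indicator_of_mem (hfar v' hv')]
        _ = _ := hσμ.lintegral_comp
            (hΨm.indicator Metric.isClosed_closedBall.measurableSet.compl)
    rw [mul_assoc]
    refine mul_le_mul' (ENNReal.ofReal_le_ofReal (Real.exp_le_exp.2 ?_))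
      ((hloc f hf.1 h v).trans (mul_le_mul_right hinner _))
    rw [← mul_neg]
    refine mul_le_mul_of_nonneg_left ((hsuppb h).2.trans ?_) hp.le
    gcongr

end Estimates

/-! ### Inequalities between Bernstein norms -/

theorem theorem3p2 {E F : Type*}
    [NormedAddCommGroup E] [InnerProductSpace ℂ E] [FiniteDimensional ℂ E]
    [MeasurableSpace E] [BorelSpace E]
    [NormedAddCommGroup F] [InnerProductSpace ℝ F] [FiniteDimensional ℝ F]
    [MeasurableSpace F] [BorelSpace F]
    (μ : Measure (E × F)) [μ.IsAddHaarMeasure]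
    (Φ : E →ₗ[ℂ] E →ₗ⋆[ℂ] Complexification F) (hΦ : IsHermitianMap Φ)
    (K : Set (StrongDual ℝ F)) (hK : IsCompact K) (hKc : Convex ℝ K)
    (p : ℝ≥0∞) (hp0 : 0 < p) (hp : p < ∞) :
    (∃ C : ℝ, 0 < C ∧ ∀ h : F, h ≠ 0 → ∀ q : ℝ≥0∞, p ≤ q → ∀ f ∈ bernsteinSpace Φ μ p K,
      eLpNorm (slice Φ f h) q μ ≤
        ENNReal.ofReal (C / ‖h‖ ^ ((p⁻¹).toReal - (q⁻¹).toReal)) *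
          EReal.exp (suppFun K h) * bernsteinNorm Φ μ p f) ∧
    (∀ q : ℝ≥0∞, p ≤ q → bernsteinSpace Φ μ p K ⊆ bernsteinSpace Φ μ q K ∧
      ∃ C : ℝ, 0 < C ∧ ∀ f ∈ bernsteinSpace Φ μ p K,
        bernsteinNorm Φ μ q f ≤ ENNReal.ofReal C * bernsteinNorm Φ μ p f) ∧
    (∀ f ∈ bernsteinSpace Φ μ p K,
      Tendsto (fun w : E × Complexification F => EReal.exp (-suppFun K (rho Φ w)) * ‖f w‖ₑ)
        (cocompact (E × Complexification F)) (𝓝 0)) := by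
  rcases K.eq_empty_or_nonempty with rfl | hne
  · have hzero : ∀ h : F, slice Φ (0 : E × Complexification F → ℂ) h = 0 := fun h => rfl
    refine ⟨⟨1, one_pos, fun h _ q _ f hf => ?_⟩, fun q _ => ⟨fun f hf => ?_, 1, one_pos,
      fun f hf => ?_⟩, fun f hf => ?_⟩
    · rw [eq_zero_of_mem_expTypeSpace_empty hf.1, hzero, eLpNorm_zero]
      exact zero_le
    · refine ⟨hf.1, ?_⟩
      rw [eq_zero_of_mem_expTypeSpace_empty hf.1, hzero]
      exact MemLp.zero'
    · rw [eq_zero_of_mem_expTypeSpace_empty hf.1, bernsteinNorm, hzero, eLpNorm_zero]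
      exact zero_le
    · rw [eq_zero_of_mem_expTypeSpace_empty hf.1]
      simpa using tendsto_const_nhds
  have hP : 0 < p.toReal := ENNReal.toReal_pos hp0.ne' hp.ne
  have hPinv : (p⁻¹).toReal = p.toReal⁻¹ := ENNReal.toReal_inv p
  obtain ⟨C, hC, hbound⟩ := exists_enorm_slice_rpow_le_lintegral μ hΦ hP hK hne
  have hnorm : ∀ f : E × Complexification F → ℂ, bernsteinNorm Φ μ p f =
      (∫⁻ v, ‖slice Φ f 0 v‖ₑ ^ p.toReal ∂μ) ^ (p⁻¹).toReal := fun f => by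
    rw [bernsteinNorm, eLpNorm_eq_lintegral_rpow_enorm_toReal hp0.ne' hp.ne, one_div, hPinv]
  have hfin : ∀ f ∈ bernsteinSpace Φ μ p K, ∫⁻ v, ‖slice Φ f 0 v‖ₑ ^ p.toReal ∂μ ≠ ∞ :=
    fun f hf => (lintegral_rpow_enorm_lt_top_of_eLpNorm_lt_top hp0.ne' hp.ne hf.2.2).ne
  have hθ : ∀ q, p ≤ q → 0 ≤ (p⁻¹).toReal - (q⁻¹).toReal := fun q hq =>
    sub_nonneg.2 (ENNReal.toReal_mono (ENNReal.inv_ne_top.2 hp0.ne') (ENNReal.inv_le_inv.2 hq))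
  have hembed : ∀ q, p ≤ q → ∀ f ∈ bernsteinSpace Φ μ p K, bernsteinNorm Φ μ q f ≤
      ENNReal.ofReal (C ^ ((p⁻¹).toReal - (q⁻¹).toReal)) * bernsteinNorm Φ μ p f := by
    intro q hq f hf
    have hzero : realSupp K 0 = 0 := by
      simpa using realSupp_smul hK hne le_rfl (0 : F)
    have h1 := eLpNorm_le_rpow_mul_rpow (μ := μ) (g := slice Φ f 0) (b := ENNReal.ofReal C)
      hp0 hp hq ENNReal.ofReal_ne_top (hfin f hf) (fun v => ?_) le_rfl
    · rwa [ENNReal.ofReal_rpow_of_pos hC, ← hnorm] at h1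
    · simpa [hzero] using (hbound f hf.1 0 v).1
  -- The constant `C ^ (1 / p - 1 / q)` is at most `max 1 C ^ (1 / p)` for all `q ≥ p`.
  refine ⟨⟨(max 1 C) ^ (p⁻¹).toReal, by positivity, fun h hh q hq f hf => ?_⟩,
    fun q hq => ⟨fun f hf => ⟨hf.1, ?_, ?_⟩, _, Real.rpow_pos_of_pos hC _, hembed q hq⟩,
    fun f hf => tendsto_exp_neg_suppFun_mul hΦ hP hK hne hf.1 (hfin f hf)⟩
  · have hh' : 0 < ‖h‖ := norm_pos_iff.2 hh
    have h1 := eLpNorm_le_rpow_mul_rpow (μ := μ) (g := slice Φ f h)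
      (b := ENNReal.ofReal (C / ‖h‖))
      (A := ENNReal.ofReal (Real.exp (p.toReal * realSupp K h)) *
        ∫⁻ v, ‖slice Φ f 0 v‖ₑ ^ p.toReal ∂μ) hp0 hp hq
      ENNReal.ofReal_ne_top (ENNReal.mul_ne_top ENNReal.ofReal_ne_top (hfin f hf)) (fun v => ?_)
      (lintegral_slice_le hP hK hne hf.1 h)
    · refine h1.trans ?_
      rw [ENNReal.mul_rpow_of_nonneg _ _ ENNReal.toReal_nonneg, ← hnorm, ← mul_assoc,
        coe_realSupp hK hne, EReal.exp_coe,
        ENNReal.ofReal_rpow_of_nonneg (Real.exp_pos _).le ENNReal.toReal_nonneg, ← Real.exp_mul,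
        hPinv, mul_right_comm p.toReal, mul_inv_cancel₀ hP.ne', one_mul, ← hPinv,
        ENNReal.ofReal_rpow_of_pos (div_pos hC hh')]
      refine mul_le_mul_left (mul_le_mul_left (ENNReal.ofReal_le_ofReal ?_) _) _
      rw [Real.div_rpow hC.le hh'.le]
      gcongr
      calc C ^ ((p⁻¹).toReal - (q⁻¹).toReal)
          ≤ (max 1 C) ^ ((p⁻¹).toReal - (q⁻¹).toReal) :=
            Real.rpow_le_rpow hC.le (le_max_right _ _) (hθ q hq)
        _ ≤ _ := Real.rpow_le_rpow_of_exponent_le (le_max_left _ _)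
            (sub_le_self _ ENNReal.toReal_nonneg)
    · rw [← mul_assoc, ← ENNReal.ofReal_mul (by positivity)]
      exact (hbound f hf.1 h v).2 hh
  · have : ProperSpace E := FiniteDimensional.proper ℂ E
    have : Continuous (slice Φ f 0) :=
      (continuous_slice (Φ := Φ) hf.1.1.continuous).comp (Continuous.prodMk_left 0)
    exact this.aestronglyMeasurable
  · refine (hembed q hq f hf).trans_lt (ENNReal.mul_lt_top ENNReal.ofReal_lt_top ?_)
    exact hf.2.2
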